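/- Let $(\bar M, g, F)$ be a locally product Riemannian manifold: a smooth Riemannian manifold with Levi-Civita connection $\bar\nabla$ and a smooth $(1,1)$-tensor field $F$ with $F^2 = I$, $F \neq \pm I$, $g(FX, FY) = g(X,Y)$ and $\bar\nabla F = 0$. Let $M$ be a Riemannian manifold isometrically immersed in $\bar M$ (its metric is also denoted by $g$), with Levi-Civita connection $\nabla$ and second fundamental form $\sigma$, so that $\sigma(X,Y)$ is the normal component of $\bar\nabla_X Y$. For $X$ tangent to $M$ write $FX = TX + \omega X$, where $TX$ is tangent and $\omega X$ is normal to $M$. Suppose that $M$ is a pointwise bi-slant submanifold, that is, there are orthogonal smooth distributions $D_1, D_2$ on $M$ with $TM = D_1 \oplus D_2$, $FD_1 \perp D_2$, $FD_2 \perp D_1$, and functions $\theta_1, \theta_2$ on $M$ (the slant functions) such that for $i = 1, 2$, every $p \in M$ and every non-zero $X \in (D_i)_p$, the angle between $FX$ and $(D_i)_p$ equals $\theta_i(p)$. Let $P_i$ be the orthogonal projection of $TM$ onto $D_i$ and $T_i = P_i \circ T$. Assume that $\theta_1$ and $\theta_2$ are distinct. Then: (i) for all smooth vector fields $X, Y$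 in $D_1$ and $Z$ in $D_2$, $$(\sin^2\theta_2 - \sin^2\theta_1)\, g(\nabla_X Y, Z) = g(\sigma(X,Z), \omega T_1 Y) + g(\sigma(X, T_2 Z), \omega Y) + g(\sigma(X,Y), \omega T_2 Z) + g(\sigma(X, T_1 Y), \omega Z);$$ (ii) for all smooth vector fields $Z, W$ in $D_2$ and $X$ in $D_1$, $$(\sin^2\theta_1 - \sin^2\theta_2)\, g(\nabla_Z W, X) = g(\sigma(X,Z), \omega T_2 W) + g(\sigma(Z, T_1 X), \omega W) + g(\sigma(Z,W), \omega T_1 X) + g(\sigma(Z, T_2 W), \omega X).$$ -/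

import Mathlib

open Bundle
open scoped Manifold ContDiff Topology

namespace BiSlant

noncomputable section

/-- The angle, in `[0, π/2]`, between a vector `v` and a subspace `W` of an inner product space:
the angle between `v` and its orthogonal projection to `W` (it is `π/2` if `v` is orthogonal
to `W`). -/
def angleWith {V : Type*} [NormedAddCommGroup V] [InnerProductSpace ℝ V]
    (v : V) (W : Submodule ℝ V) [W.HasOrthogonalProjection] : ℝ :=
  InnerProductGeometry.angle v (W.starProjection v)

section OneManifold

variable {E : Type*} [NormedAddCommGroup E] [NormedSpace ℝ E] [FiniteDimensional ℝ E]
  {M : Type*} [TopologicalSpace M] [ChartedSpace E M]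

instance instFiniteDimensionalTangentSpace (x : M) :
    FiniteDimensional ℝ (TangentSpace 𝓘(ℝ, E) x) :=
  inferInstanceAs (FiniteDimensional ℝ E)

/-- The vector field `X` is smooth. -/
def IsSmoothField (X : ∀ x : M, TangentSpace 𝓘(ℝ, E) x) [IsManifold 𝓘(ℝ, E) ∞ M] : Prop :=
  ContMDiff 𝓘(ℝ, E) 𝓘(ℝ, E).tangent ∞ (fun x ↦ (⟨x, X x⟩ : TangentBundle 𝓘(ℝ, E) M))

/-- A smooth distribution: near every point it has a frame of smooth vector fields. -/
def IsSmoothDistribution [IsManifold 𝓘(ℝ, E) ∞ M]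
    (D : ∀ x : M, Submodule ℝ (TangentSpace 𝓘(ℝ, E) x)) : Prop :=
  ∀ p : M, ∃ U ∈ 𝓝 p, ∃ (k : ℕ) (v : Fin k → ∀ x : M, TangentSpace 𝓘(ℝ, E) x),
    (∀ i, ContMDiffOn 𝓘(ℝ, E) 𝓘(ℝ, E).tangent ∞
      (fun x ↦ (⟨x, v i x⟩ : TangentBundle 𝓘(ℝ, E) M)) U) ∧
    ∀ x ∈ U, LinearIndependent ℝ (fun i ↦ v i x) ∧
      Submodule.span ℝ (Set.range fun i ↦ v i x) = D x

variable [IsManifold 𝓘(ℝ, E) ∞ M]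
  [RiemannianBundle (fun x : M ↦ TangentSpace 𝓘(ℝ, E) x)]
  [IsContMDiffRiemannianBundle 𝓘(ℝ, E) ∞ E (fun x : M ↦ TangentSpace 𝓘(ℝ, E) x)]

/-- `cov` is the Levi-Civita connection: it is torsion-free and compatible with the metric. -/
structure IsLeviCivita
    (cov : CovariantDerivative 𝓘(ℝ, E) E (fun x : M ↦ TangentSpace 𝓘(ℝ, E) x)) : Prop where
  torsion_eq_zero : cov.torsion = 0
  isMetricCompatible : CovariantDerivative.IsMetricCompatible
    (V := fun x : M ↦ TangentSpace 𝓘(ℝ, E) x) (F := E) cov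

/-- `F` is an almost product structure, compatible with the Riemannian metric: a smooth tensor
field of type (1,1) with `F² = I`, `F ≠ ± I` and `g(FX, FY) = g(X, Y)`. -/
structure IsAlmostProductRiemannian
    (F : ∀ x : M, TangentSpace 𝓘(ℝ, E) x →L[ℝ] TangentSpace 𝓘(ℝ, E) x) : Prop where
  smooth : ContMDiff 𝓘(ℝ, E) (𝓘(ℝ, E).prod 𝓘(ℝ, E →L[ℝ] E)) ∞
    (fun x ↦ TotalSpace.mk' (E →L[ℝ] E)
      (E := fun x : M ↦ TangentSpace 𝓘(ℝ, E) x →L[ℝ] TangentSpace 𝓘(ℝ, E) x) x (F x))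
  sq_eq : ∀ (x : M) (u : TangentSpace 𝓘(ℝ, E) x), F x (F x u) = u
  ne_id : F ≠ fun x ↦ ContinuousLinearMap.id ℝ (TangentSpace 𝓘(ℝ, E) x)
  ne_neg_id : F ≠ fun x ↦ -ContinuousLinearMap.id ℝ (TangentSpace 𝓘(ℝ, E) x)
  inner_map_map : ∀ (x : M) (u v : TangentSpace 𝓘(ℝ, E) x),
    inner ℝ (F x u) (F x v) = inner ℝ u v

/-- `(M, g, F)` with Levi-Civita connection `cov` is a locally product Riemannian manifold:
moreover `(∇_v F) Y = ∇_v (F Y) - F (∇_v Y) = 0` for tangent vectors `v` at `x` and vector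
fields `Y` that are smooth at `x`. -/
structure IsLocallyProductRiemannian
    (cov : CovariantDerivative 𝓘(ℝ, E) E (fun x : M ↦ TangentSpace 𝓘(ℝ, E) x))
    (F : ∀ x : M, TangentSpace 𝓘(ℝ, E) x →L[ℝ] TangentSpace 𝓘(ℝ, E) x) : Prop
    extends IsAlmostProductRiemannian F where
  isLeviCivita : IsLeviCivita cov
  parallel : ∀ (Y : ∀ x : M, TangentSpace 𝓘(ℝ, E) x) (x : M),
    ContMDiffAt 𝓘(ℝ, E) 𝓘(ℝ, E).tangent ∞
      (fun x ↦ (⟨x, Y x⟩ : TangentBundle 𝓘(ℝ, E) M)) x →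
    ∀ v : TangentSpace 𝓘(ℝ, E) x, cov (fun y ↦ F y (Y y)) x v - F x (cov Y x v) = 0

end OneManifold

section Submanifold

variable {E : Type*} [NormedAddCommGroup E] [NormedSpace ℝ E] [FiniteDimensional ℝ E]
  {M : Type*} [TopologicalSpace M] [ChartedSpace E M] [IsManifold 𝓘(ℝ, E) ∞ M]
  {E' : Type*} [NormedAddCommGroup E'] [NormedSpace ℝ E'] [FiniteDimensional ℝ E']
  {N : Type*} [TopologicalSpace N] [ChartedSpace E' N] [IsManifold 𝓘(ℝ, E') ∞ N]

/-- The covariant derivative `∇_v V` of a vector field `V` along a map `f : M → N` in the direction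
`v ∈ T_p M` (the pull-back connection). If `e₁, …, e_m` is the coordinate frame of `TN` near `f p`
and `V = ∑ Vⁱ (eᵢ ∘ f)`, then `∇_v V = ∑ (v(Vⁱ) eᵢ + Vⁱ(p) ∇_{df v} eᵢ)`. -/
def covAlong (cov : CovariantDerivative 𝓘(ℝ, E') E' (fun y : N ↦ TangentSpace 𝓘(ℝ, E') y))
    (f : M → N) (V : ∀ x : M, TangentSpace 𝓘(ℝ, E') (f x))
    (p : M) (v : TangentSpace 𝓘(ℝ, E) p) : TangentSpace 𝓘(ℝ, E') (f p) :=
  let e := trivializationAt E' (fun y : N ↦ TangentSpace 𝓘(ℝ, E') y) (f p)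
  let b := Module.finBasis ℝ E'
  ∑ i, (mvfderiv 𝓘(ℝ, E) (fun q ↦ e.localFrameCoeff 𝓘(ℝ, E') b i (f q) (V q)) p v •
        e.localFrame b i (f p) +
      e.localFrameCoeff 𝓘(ℝ, E') b i (f p) (V p) •
        cov (e.localFrame b i) (f p) (mfderiv 𝓘(ℝ, E) 𝓘(ℝ, E') f p v))

variable [RiemannianBundle (fun x : M ↦ TangentSpace 𝓘(ℝ, E) x)]
  [IsContMDiffRiemannianBundle 𝓘(ℝ, E) ∞ E (fun x : M ↦ TangentSpace 𝓘(ℝ, E) x)]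
  [RiemannianBundle (fun y : N ↦ TangentSpace 𝓘(ℝ, E') y)]
  [IsContMDiffRiemannianBundle 𝓘(ℝ, E') ∞ E' (fun y : N ↦ TangentSpace 𝓘(ℝ, E') y)]

/-- `f : M → N` is an isometric immersion: it is smooth and the metric of `M` is the one induced
by `f` (so that the differentials of `f` are injective). -/
structure IsIsometricImmersion (f : M → N) : Prop where
  contMDiff : ContMDiff 𝓘(ℝ, E) 𝓘(ℝ, E') ∞ f
  inner_mfderiv : ∀ (x : M) (u v : TangentSpace 𝓘(ℝ, E) x),
    inner ℝ (mfderiv 𝓘(ℝ, E) 𝓘(ℝ, E') f x u) (mfderiv 𝓘(ℝ, E) 𝓘(ℝ, E') f x v) = inner ℝ u v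

/-- The tangential component of `w ∈ T_{f x} N`, as a vector of `T_x M`. It is the image of `w`
under the adjoint of `df_x`; see `inner_normalPart_mfderiv`. -/
def tangentPart (f : M → N) (x : M) (w : TangentSpace 𝓘(ℝ, E') (f x)) : TangentSpace 𝓘(ℝ, E) x :=
  ContinuousLinearMap.adjoint (mfderiv 𝓘(ℝ, E) 𝓘(ℝ, E') f x) w

/-- The normal component of `w ∈ T_{f x} N`. -/
def normalPart (f : M → N) (x : M) (w : TangentSpace 𝓘(ℝ, E') (f x)) :
    TangentSpace 𝓘(ℝ, E') (f x) :=
  w - mfderiv 𝓘(ℝ, E) 𝓘(ℝ, E') f x (tangentPart (E := E) (E' := E') f x w)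

set_option linter.unusedSectionVars false in
/-- `w = df (tangentPart w) + normalPart w` is the orthogonal decomposition of `w` with respect to
the image of `df_x`. -/
theorem inner_normalPart_mfderiv {f : M → N} (hf : IsIsometricImmersion (E := E) (E' := E') f) (x : M)
    (w : TangentSpace 𝓘(ℝ, E') (f x)) (u : TangentSpace 𝓘(ℝ, E) x) :
    inner ℝ (normalPart (E := E) (E' := E') f x w) (mfderiv 𝓘(ℝ, E) 𝓘(ℝ, E') f x u) = 0 := by
  rw [normalPart, inner_sub_left, hf.inner_mfderiv, tangentPart,
    ContinuousLinearMap.adjoint_inner_left, sub_self]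

/-- The second fundamental form `σ(X, Y)`, the normal component of `∇_X Y`, where `∇` is the
connection of the ambient manifold. -/
def secondFundamentalForm
    (cov : CovariantDerivative 𝓘(ℝ, E') E' (fun y : N ↦ TangentSpace 𝓘(ℝ, E') y))
    (f : M → N) (X Y : ∀ x : M, TangentSpace 𝓘(ℝ, E) x) (p : M) :
    TangentSpace 𝓘(ℝ, E') (f p) :=
  normalPart (E := E) f p
    (covAlong (E := E) cov f (fun x ↦ mfderiv 𝓘(ℝ, E) 𝓘(ℝ, E') f x (Y x)) p (X p))

variable (F : ∀ y : N, TangentSpace 𝓘(ℝ, E') y →L[ℝ] TangentSpace 𝓘(ℝ, E') y) (f : M → N)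

/-- `TX`, the tangential component of `FX`. -/
def tanF (x : M) (u : TangentSpace 𝓘(ℝ, E) x) : TangentSpace 𝓘(ℝ, E) x :=
  tangentPart (E' := E') f x (F (f x) (mfderiv 𝓘(ℝ, E) 𝓘(ℝ, E') f x u))

/-- `ωX`, the normal component of `FX`. -/
def norF (x : M) (u : TangentSpace 𝓘(ℝ, E) x) : TangentSpace 𝓘(ℝ, E') (f x) :=
  normalPart (E := E) f x (F (f x) (mfderiv 𝓘(ℝ, E) 𝓘(ℝ, E') f x u))

/-- `P ∘ T`, where `P` is the orthogonal projection to the distribution `D`. -/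
def projTanF (D : ∀ x : M, Submodule ℝ (TangentSpace 𝓘(ℝ, E) x)) (x : M)
    (u : TangentSpace 𝓘(ℝ, E) x) : TangentSpace 𝓘(ℝ, E) x :=
  (D x).starProjection (tanF F f x u)

/-- The distribution `D` on `M` is pointwise slant with slant function `θ`: at every point `x`,
the angle between `FX` and `D_x` is `θ x` for every non-zero `X ∈ D_x`. -/
def IsPointwiseSlant (D : ∀ x : M, Submodule ℝ (TangentSpace 𝓘(ℝ, E) x)) (θ : M → ℝ) : Prop :=
  ∀ (x : M), ∀ u ∈ D x, u ≠ 0 →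
    angleWith (F (f x) (mfderiv 𝓘(ℝ, E) 𝓘(ℝ, E') f x u))
      ((D x).map (mfderiv 𝓘(ℝ, E) 𝓘(ℝ, E') f x : TangentSpace 𝓘(ℝ, E) x →ₗ[ℝ] _)) = θ x

/-- The isometrically immersed manifold `M` is a pointwise bi-slant submanifold with respect to
the distributions `D₁`, `D₂` and the slant functions `θ₁`, `θ₂`. -/
structure IsPointwiseBiSlant (D₁ D₂ : ∀ x : M, Submodule ℝ (TangentSpace 𝓘(ℝ, E) x))
    (θ₁ θ₂ : M → ℝ) : Prop where
  isometric : IsIsometricImmersion (E := E) (E' := E') f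
  smooth₁ : IsSmoothDistribution D₁
  smooth₂ : IsSmoothDistribution D₂
  orthogonal : ∀ x, D₁ x ⟂ D₂ x
  sup_eq_top : ∀ x, D₁ x ⊔ D₂ x = ⊤
  map₁ : ∀ x, ∀ u ∈ D₁ x, ∀ v ∈ D₂ x,
    inner ℝ (F (f x) (mfderiv 𝓘(ℝ, E) 𝓘(ℝ, E') f x u)) (mfderiv 𝓘(ℝ, E) 𝓘(ℝ, E') f x v) = 0
  map₂ : ∀ x, ∀ u ∈ D₂ x, ∀ v ∈ D₁ x,
    inner ℝ (F (f x) (mfderiv 𝓘(ℝ, E) 𝓘(ℝ, E') f x u)) (mfderiv 𝓘(ℝ, E) 𝓘(ℝ, E') f x v) = 0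
  slant₁ : IsPointwiseSlant F f D₁ θ₁
  slant₂ : IsPointwiseSlant F f D₂ θ₂

end Submanifold

end

end BiSlant

/-! Write `∇̄` for the ambient connection along `f`, and let `Y` lie in `D₁`, `Z` in `D₂`. Since `F
D₁ ⊥ D₂`, `T` preserves each `Dᵢ`, so `Tᵢ = T` there, and `g(F T Y, Z)` vanishes identically.
Differentiate this along `X`: `F` is parallel and self-adjoint, `FZ = TZ + ωZ`, and the slant
condition amounts to `T² = cos² θᵢ` on `Dᵢ`. This gives `g(∇̄_X TY, TZ) + g(σ(X,TY), ωZ) = -cos² θ₁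
g(∇_X Z, Y) - g(σ(X,Z), ωTY)`. Add the same identity with `Y, D₁` and `Z, D₂` exchanged. The two
terms without `σ` on the left add up to `X g(TY, TZ) = 0`, and `g(∇_X Z, Y) = -g(∇_X Y, Z)` because
`Y ⊥ Z`. What remains is (i), as `cos² θ₁ - cos² θ₂ = sin² θ₂ - sin² θ₁`. The slant functions are
never differentiated: `T² = cos² θᵢ` is used only at the point `p`. Statement (ii) is (i) with the
distributions exchanged, up to the symmetry of `σ`.

The geometry is in `adjoint_map_adjoint_map_eq_cos_sq_smul` (slant condition),
`IsPointwiseBiSlant.inner_covAlong_tanF` (the displayed identity) and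
`IsPointwiseBiSlant.sin_sq_sub_sin_sq_mul_inner` (the sum). The rest is calculus for `covAlong`,
which is defined by a coordinate frame: parallel fields pass through it (`covAlong_map`), it is
metric (`IsLeviCivita.mvfderiv_inner_along`) and torsion-free (`covAlong_mfderiv_sub`). The last two
yield the Gauss formula and the symmetry of `σ`. -/

namespace BiSlant

noncomputable section

/-! ### Lie brackets as commutators of derivations, by computation in a chart. -/

section LieBracket

set_option linter.unusedSectionVars false

variable {E : Type*} [NormedAddCommGroup E] [NormedSpace ℝ E] [FiniteDimensional ℝ E]
  {M : Type*} [TopologicalSpace M] [ChartedSpace E M] [IsManifold 𝓘(ℝ, E) ∞ M]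

/-- The vector field `X`, read in the chart at `p`. -/
def chartField (p : M) (X : ∀ x : M, TangentSpace 𝓘(ℝ, E) x) : E → E :=
  VectorField.mpullbackWithin 𝓘(ℝ, E) 𝓘(ℝ, E) (extChartAt 𝓘(ℝ, E) p).symm X
    (Set.range 𝓘(ℝ, E))

theorem differentiableAt_chartField {p : M} {X : ∀ x : M, TangentSpace 𝓘(ℝ, E) x}
    (hX : MDifferentiableAt 𝓘(ℝ, E) 𝓘(ℝ, E).tangent
      (fun x ↦ (⟨x, X x⟩ : TangentBundle 𝓘(ℝ, E) M)) p) :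
    DifferentiableAt ℝ (chartField p X) (extChartAt 𝓘(ℝ, E) p p) := by
  have : IsManifold 𝓘(ℝ, E) 2 M := .of_le (n := ∞) (by norm_cast)
  have := (mdifferentiableWithinAt_univ.2 hX).differentiableWithinAt_mpullbackWithin_vectorField
  rw [← differentiableWithinAt_univ]
  simpa [chartField] using! this

/-- The derivative of a function along a vector field, computed in a chart. -/
theorem mvfderiv_apply_eq_fderiv_chartField {p : M} {u : E}
    (hu : u ∈ (extChartAt 𝓘(ℝ, E) p).target) {k : M → ℝ}
    (hk : MDifferentiableAt 𝓘(ℝ, E) 𝓘(ℝ, ℝ) k ((extChartAt 𝓘(ℝ, E) p).symm u))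
    (X : ∀ x : M, TangentSpace 𝓘(ℝ, E) x) :
    mvfderiv 𝓘(ℝ, E) k ((extChartAt 𝓘(ℝ, E) p).symm u) (X ((extChartAt 𝓘(ℝ, E) p).symm u)) =
      fderiv ℝ (k ∘ (extChartAt 𝓘(ℝ, E) p).symm) u (chartField p X u) := by
  have : IsManifold 𝓘(ℝ, E) 1 M := .of_le (n := ∞) (by norm_cast)
  have hinv := isInvertible_mfderivWithin_extChartAt_symm hu
  have hd := mdifferentiableWithinAt_extChartAt_symm hu
  simp only [modelWithCornersSelf_coe, Set.range_id, mfderivWithin_univ,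
    mdifferentiableWithinAt_univ] at hinv hd
  have h1 := mvfderiv_comp_apply u hk hd (chartField (E := E) p X u)
  have h2 : mfderiv 𝓘(ℝ, E) 𝓘(ℝ, E) (extChartAt 𝓘(ℝ, E) p).symm u (chartField (E := E) p X u) =
      X ((extChartAt 𝓘(ℝ, E) p).symm u) := by
    simp only [chartField, VectorField.mpullbackWithin_apply, modelWithCornersSelf_coe,
      Set.range_id, mfderivWithin_univ]
    exact hinv.self_apply_inverse _
  rw [h2] at h1
  rw [← h1, mvfderiv, mfderiv_eq_fderiv]
  rfl


theorem contDiffAt_comp_extChartAt_symm {p : M} {h : M → ℝ}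
    (hh : ContMDiffAt 𝓘(ℝ, E) 𝓘(ℝ, ℝ) ∞ h p) :
    ContDiffAt ℝ ∞ (h ∘ (extChartAt 𝓘(ℝ, E) p).symm) (extChartAt 𝓘(ℝ, E) p p) := by
  rw [← contDiffWithinAt_univ]
  simpa [Function.comp_def, chartAt_self_eq] using (contMDiffAt_iff.1 hh).2

/-- The iterated derivative of a function along vector fields, and its differentiability. -/
theorem hasFDerivAt_fderiv_chartField {p : M} {h : M → ℝ}
    (hh : ContMDiffAt 𝓘(ℝ, E) 𝓘(ℝ, ℝ) ∞ h p) {Y : ∀ x : M, TangentSpace 𝓘(ℝ, E) x}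
    (hY : MDifferentiableAt 𝓘(ℝ, E) 𝓘(ℝ, E).tangent
      (fun x ↦ (⟨x, Y x⟩ : TangentBundle 𝓘(ℝ, E) M)) p) :
    HasFDerivAt ((fun q ↦ mvfderiv 𝓘(ℝ, E) h q (Y q)) ∘ (extChartAt 𝓘(ℝ, E) p).symm)
      ((fderiv ℝ (h ∘ (extChartAt 𝓘(ℝ, E) p).symm) (extChartAt 𝓘(ℝ, E) p p)).comp
          (fderiv ℝ (chartField p Y) (extChartAt 𝓘(ℝ, E) p p)) +
        (fderiv ℝ (fderiv ℝ (h ∘ (extChartAt 𝓘(ℝ, E) p).symm))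
          (extChartAt 𝓘(ℝ, E) p p)).flip (chartField p Y (extChartAt 𝓘(ℝ, E) p p)))
      (extChartAt 𝓘(ℝ, E) p p) := by
  have hh' := contDiffAt_comp_extChartAt_symm hh
  have hd : DifferentiableAt ℝ (fderiv ℝ (h ∘ (extChartAt 𝓘(ℝ, E) p).symm))
      (extChartAt 𝓘(ℝ, E) p p) :=
    -- In the chart, `Y h` is `u ↦ Dh(u)(Y(u))`; the claimed derivative is the product rule for this
    -- pairing.
    (hh'.fderiv_right (m := 1) (by norm_cast)).differentiableAt (by norm_num)
  refine (hd.hasFDerivAt.clm_apply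
    (differentiableAt_chartField hY).hasFDerivAt).congr_of_eventuallyEq ?_
  have hev : ∀ᶠ q in 𝓝 p, MDifferentiableAt 𝓘(ℝ, E) 𝓘(ℝ, ℝ) h q := by
    have : ContMDiffAt 𝓘(ℝ, E) 𝓘(ℝ, ℝ) 1 h p := hh.of_le (by norm_cast)
    filter_upwards [(contMDiffAt_iff_contMDiffAt_nhds (by simp)).1 this] with q hq
    exact ContMDiffAt.mdifferentiableAt hq (by simp)
  have hev' := (continuousAt_extChartAt_symm (I := 𝓘(ℝ, E)) p).eventually
    (by simpa using hev)
  filter_upwards [hev', extChartAt_target_mem_nhds (I := 𝓘(ℝ, E)) p] with u hu hu'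
  exact mvfderiv_apply_eq_fderiv_chartField hu' hu Y

theorem mdifferentiableAt_of_differentiableAt_chart {p : M} {k : M → ℝ}
    (hk : DifferentiableAt ℝ (k ∘ (extChartAt 𝓘(ℝ, E) p).symm) (extChartAt 𝓘(ℝ, E) p p)) :
    MDifferentiableAt 𝓘(ℝ, E) 𝓘(ℝ, ℝ) k p := by
  have : IsManifold 𝓘(ℝ, E) 1 M := .of_le (n := ∞) (by norm_cast)
  have h1 : MDifferentiableAt 𝓘(ℝ, E) 𝓘(ℝ, ℝ)
      ((k ∘ (extChartAt 𝓘(ℝ, E) p).symm) ∘ extChartAt 𝓘(ℝ, E) p) p :=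
    hk.mdifferentiableAt.comp p (mdifferentiableAt_extChartAt (mem_chart_source E p))
  refine h1.congr_of_eventuallyEq ?_
  filter_upwards [extChartAt_source_mem_nhds (I := 𝓘(ℝ, E)) p] with q hq
  simp only [Function.comp_apply, (extChartAt 𝓘(ℝ, E) p).left_inv hq]

/-- The derivative of a smooth function along a differentiable vector field is differentiable. -/
theorem mdifferentiableAt_mvfderiv_apply {p : M} {h : M → ℝ}
    (hh : ContMDiffAt 𝓘(ℝ, E) 𝓘(ℝ, ℝ) ∞ h p) {Y : ∀ x : M, TangentSpace 𝓘(ℝ, E) x}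
    (hY : MDifferentiableAt 𝓘(ℝ, E) 𝓘(ℝ, E).tangent
      (fun x ↦ (⟨x, Y x⟩ : TangentBundle 𝓘(ℝ, E) M)) p) :
    MDifferentiableAt 𝓘(ℝ, E) 𝓘(ℝ, ℝ) (fun q ↦ mvfderiv 𝓘(ℝ, E) h q (Y q)) p :=
  mdifferentiableAt_of_differentiableAt_chart
    (hasFDerivAt_fderiv_chartField hh hY).differentiableAt

theorem mvfderiv_apply_eq_fderiv_chartField_self {p : M} {k : M → ℝ}
    (hk : MDifferentiableAt 𝓘(ℝ, E) 𝓘(ℝ, ℝ) k p) (X : ∀ x : M, TangentSpace 𝓘(ℝ, E) x) :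
    mvfderiv 𝓘(ℝ, E) k p (X p) = fderiv ℝ (k ∘ (extChartAt 𝓘(ℝ, E) p).symm)
      (extChartAt 𝓘(ℝ, E) p p) (chartField p X (extChartAt 𝓘(ℝ, E) p p)) := by
  have hp : (extChartAt 𝓘(ℝ, E) p).symm (extChartAt 𝓘(ℝ, E) p p) = p := extChartAt_to_inv p
  rw [← mvfderiv_apply_eq_fderiv_chartField (mem_extChartAt_target p) (by rwa [hp]) X]
  exact (congrArg (fun q ↦ mvfderiv 𝓘(ℝ, E) k q (X q)) hp).symm

/-- A Lie bracket acts on functions as the commutator of the derivations. -/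
theorem mvfderiv_mlieBracket {p : M} {h : M → ℝ}
    (hh : ContMDiffAt 𝓘(ℝ, E) 𝓘(ℝ, ℝ) ∞ h p) {X Y : ∀ x : M, TangentSpace 𝓘(ℝ, E) x}
    (hX : MDifferentiableAt 𝓘(ℝ, E) 𝓘(ℝ, E).tangent
      (fun x ↦ (⟨x, X x⟩ : TangentBundle 𝓘(ℝ, E) M)) p)
    (hY : MDifferentiableAt 𝓘(ℝ, E) 𝓘(ℝ, E).tangent
      (fun x ↦ (⟨x, Y x⟩ : TangentBundle 𝓘(ℝ, E) M)) p) :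
    mvfderiv 𝓘(ℝ, E) h p (VectorField.mlieBracket 𝓘(ℝ, E) X Y p) =
      mvfderiv 𝓘(ℝ, E) (fun q ↦ mvfderiv 𝓘(ℝ, E) h q (Y q)) p (X p) -
        mvfderiv 𝓘(ℝ, E) (fun q ↦ mvfderiv 𝓘(ℝ, E) h q (X q)) p (Y p) := by
  have hh' := contDiffAt_comp_extChartAt_symm hh
  have : IsManifold 𝓘(ℝ, E) 1 M := .of_le (n := ∞) (by norm_cast)
  have hsymm : IsSymmSndFDerivAt ℝ (h ∘ (extChartAt 𝓘(ℝ, E) p).symm) (extChartAt 𝓘(ℝ, E) p p) :=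
    hh'.isSymmSndFDerivAt (by simp; norm_cast)
  have hbr : VectorField.mlieBracket 𝓘(ℝ, E) X Y p =
      VectorField.lieBracket ℝ (chartField p X) (chartField p Y) (extChartAt 𝓘(ℝ, E) p p) := by
    -- The manifold bracket is the chart bracket pulled back by the chart, whose derivative at its
    -- own base point is the identity.
    have hid (w : TangentSpace 𝓘(ℝ, E) (extChartAt 𝓘(ℝ, E) p p)) :
        (mfderiv 𝓘(ℝ, E) 𝓘(ℝ, E) (extChartAt 𝓘(ℝ, E) p) p).inverse w = w := by
      have h1 : mfderiv 𝓘(ℝ, E) 𝓘(ℝ, E) (extChartAt 𝓘(ℝ, E) p) p =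
          ContinuousLinearMap.id ℝ (TangentSpace 𝓘(ℝ, E) p) := mfderiv_extChartAt_self
      exact (isInvertible_mfderiv_extChartAt (mem_extChartAt_source p)).inverse_apply_eq.2
        (DFunLike.congr_fun h1 w).symm
    refine (hid _).trans ?_
    simp only [chartField, modelWithCornersSelf_coe, Set.range_id, Set.preimage_univ,
      Set.inter_univ]
    exact congrFun (VectorField.lieBracketWithin_univ (E := E)) _
  have hbr' : mvfderiv 𝓘(ℝ, E) h p (VectorField.mlieBracket 𝓘(ℝ, E) X Y p) =
      fderiv ℝ (h ∘ (extChartAt 𝓘(ℝ, E) p).symm) (extChartAt 𝓘(ℝ, E) p p)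
        (VectorField.lieBracket ℝ (chartField p X) (chartField p Y)
          (extChartAt 𝓘(ℝ, E) p p)) := by
    rw [← hbr, (hh.mdifferentiableAt (by simp)).mvfderiv]
    simp only [modelWithCornersSelf_coe, Set.range_id, fderivWithin_univ]
    rfl
  rw [hbr', mvfderiv_apply_eq_fderiv_chartField_self (mdifferentiableAt_mvfderiv_apply hh hY) X,
    mvfderiv_apply_eq_fderiv_chartField_self (mdifferentiableAt_mvfderiv_apply hh hX) Y,
    (hasFDerivAt_fderiv_chartField hh hY).fderiv, (hasFDerivAt_fderiv_chartField hh hX).fderiv,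
    VectorField.lieBracket]
  simp only [map_sub, _root_.add_apply, ContinuousLinearMap.comp_apply,
    ContinuousLinearMap.flip_apply]
  -- The second-derivative terms cancel by symmetry, leaving `Dh` applied to the bracket.
  rw [hsymm.eq]
  ring

end LieBracket

/-! ### Coordinate frames of the tangent bundle and connections in a frame. -/

section Frame

set_option linter.unusedSectionVars false

variable {E : Type*} [NormedAddCommGroup E] [NormedSpace ℝ E] [FiniteDimensional ℝ E]
  {M : Type*} [TopologicalSpace M] [ChartedSpace E M]

/-- Frame coefficients, inner products and solutions of linear systems below are all brought to this
shape before being differentiated. -/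
theorem hasMVFDeriv_sum_mul {ι : Type*} (s : Finset ι) {a c : ι → M → ℝ} {p : M}
    (ha : ∀ i, MDifferentiableAt 𝓘(ℝ, E) 𝓘(ℝ, ℝ) (a i) p)
    (hc : ∀ i, MDifferentiableAt 𝓘(ℝ, E) 𝓘(ℝ, ℝ) (c i) p) :
    MDifferentiableAt 𝓘(ℝ, E) 𝓘(ℝ, ℝ) (fun q ↦ ∑ i ∈ s, a i q * c i q) p ∧
    ∀ v, mvfderiv 𝓘(ℝ, E) (fun q ↦ ∑ i ∈ s, a i q * c i q) p v =
      ∑ i ∈ s, (mvfderiv 𝓘(ℝ, E) (a i) p v * c i p + a i p * mvfderiv 𝓘(ℝ, E) (c i) p v) := by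
  classical
  induction s using Finset.induction_on with
  | empty =>
    simp only [Finset.sum_empty]
    exact ⟨mdifferentiableAt_const, fun v ↦ by rw [mvfderiv_const]; rfl⟩
  | insert i s hi ih =>
    simp only [Finset.sum_insert hi]
    have hm : MDifferentiableAt 𝓘(ℝ, E) 𝓘(ℝ, ℝ) (fun q ↦ a i q * c i q) p := (ha i).mul (hc i)
    refine ⟨hm.add ih.1, fun v ↦ ?_⟩
    rw [mvfderiv_fun_add hm ih.1, mvfderiv_fun_mul (ha i) (hc i)]
    simp only [_root_.add_apply, ih.2, _root_.smul_apply, smul_eq_mul]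
    ring

theorem mvfderiv_congr {k k' : M → ℝ} {p : M} (h : k =ᶠ[𝓝 p] k') :
    mvfderiv 𝓘(ℝ, E) k p = mvfderiv 𝓘(ℝ, E) k' p := by
  ext v
  simp only [mvfderiv, h.mfderiv_eq]
  rfl

variable [IsManifold 𝓘(ℝ, E) ∞ M]

/-- The coordinate frame of the tangent bundle near `y₀`. -/
def frame (y₀ : M) (i : Fin (Module.finrank ℝ E)) (y : M) : TangentSpace 𝓘(ℝ, E) y :=
  (trivializationAt E (fun y : M ↦ TangentSpace 𝓘(ℝ, E) y) y₀).localFrame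
    (Module.finBasis ℝ E) i y

/-- The coefficients of a tangent vector with respect to the coordinate frame near `y₀`. -/
def coeff (y₀ : M) (i : Fin (Module.finrank ℝ E)) (y : M) : TangentSpace 𝓘(ℝ, E) y →ₗ[ℝ] ℝ :=
  (trivializationAt E (fun y : M ↦ TangentSpace 𝓘(ℝ, E) y) y₀).localFrameCoeff 𝓘(ℝ, E)
    (Module.finBasis ℝ E) i y

/-- The coordinate functions near `y₀`. -/
def coordFun (y₀ : M) (i : Fin (Module.finrank ℝ E)) (y : M) : ℝ :=
  (Module.finBasis ℝ E).coord i (extChartAt 𝓘(ℝ, E) y₀ y)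

theorem contMDiffAt_frame (y₀ : M) (i : Fin (Module.finrank ℝ E)) :
    ContMDiffAt 𝓘(ℝ, E) 𝓘(ℝ, E).tangent ∞
      (fun y ↦ (⟨y, frame y₀ i y⟩ : TangentBundle 𝓘(ℝ, E) M)) y₀ :=
  contMDiffAt_localFrame_of_mem (n := ∞) _ _ _ (FiberBundle.mem_baseSet_trivializationAt' y₀)

theorem mdifferentiableAt_frame (y₀ : M) (i : Fin (Module.finrank ℝ E)) :
    MDifferentiableAt 𝓘(ℝ, E) 𝓘(ℝ, E).tangent
      (fun y ↦ (⟨y, frame y₀ i y⟩ : TangentBundle 𝓘(ℝ, E) M)) y₀ :=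
  (contMDiffAt_frame y₀ i).mdifferentiableAt (by simp)

theorem sum_coeff_smul_frame {y₀ y : M} (hy : y ∈ (chartAt E y₀).source)
    (w : TangentSpace 𝓘(ℝ, E) y) : ∑ i, coeff y₀ i y w • frame y₀ i y = w := by
  classical
  -- The statement is pointwise, so `w` may be extended to a section by zero.
  have := Trivialization.eq_sum_localFrameCoeff_smul (I := 𝓘(ℝ, E))
    (e := trivializationAt E (fun y : M ↦ TangentSpace 𝓘(ℝ, E) y) y₀)
    (b := Module.finBasis ℝ E) (s := Function.update 0 y w) (x' := y) hy
  simpa [frame, coeff] using! this.symm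

theorem mdifferentiableAt_coeff {y₀ : M} {s : ∀ y : M, TangentSpace 𝓘(ℝ, E) y}
    (hs : MDifferentiableAt 𝓘(ℝ, E) 𝓘(ℝ, E).tangent
      (fun y ↦ (⟨y, s y⟩ : TangentBundle 𝓘(ℝ, E) M)) y₀) (i : Fin (Module.finrank ℝ E)) :
    MDifferentiableAt 𝓘(ℝ, E) 𝓘(ℝ, ℝ) (fun y ↦ coeff y₀ i y (s y)) y₀ := by
  have : IsManifold 𝓘(ℝ, E) 1 M := .of_le (n := ∞) (by norm_cast)
  exact mdifferentiableAt_localFrameCoeff (Module.finBasis ℝ E)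
    (FiberBundle.mem_baseSet_trivializationAt' y₀) hs i

theorem eventually_mem_chart_source (y₀ : M) : ∀ᶠ y in 𝓝 y₀, y ∈ (chartAt E y₀).source :=
  (chartAt E y₀).open_source.mem_nhds (mem_chart_source E y₀)

theorem contMDiffAt_coordFun (y₀ : M) (i : Fin (Module.finrank ℝ E)) :
    ContMDiffAt 𝓘(ℝ, E) 𝓘(ℝ, ℝ) ∞ (coordFun y₀ i) y₀ := by
  have h1 : ContMDiffAt 𝓘(ℝ, E) 𝓘(ℝ, E) ∞ (extChartAt 𝓘(ℝ, E) y₀) y₀ := contMDiffAt_extChartAt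
  have h2 : ContMDiff 𝓘(ℝ, E) 𝓘(ℝ, ℝ) ∞
      (LinearMap.toContinuousLinearMap ((Module.finBasis ℝ E).coord i)) :=
    (LinearMap.toContinuousLinearMap ((Module.finBasis ℝ E).coord i)).contMDiff
  exact h2.contMDiffAt.comp y₀ h1

/-- The trivialization of the tangent bundle at `y₀` is the derivative of the chart, so its
coefficients are the differentials of the coordinates. This is what turns brackets and `df` into
derivatives of functions. -/
theorem coeff_eq_mvfderiv_coordFun {y₀ y : M} (hy : y ∈ (chartAt E y₀).source)
    (i : Fin (Module.finrank ℝ E)) (w : TangentSpace 𝓘(ℝ, E) y) :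
    coeff y₀ i y w = mvfderiv 𝓘(ℝ, E) (coordFun y₀ i) y w := by
  classical
  have : IsManifold 𝓘(ℝ, E) 1 M := .of_le (n := ∞) (by norm_cast)
  have h1 := Trivialization.localFrameCoeff_eq_coeff (I := 𝓘(ℝ, E))
    (trivializationAt E (fun y : M ↦ TangentSpace 𝓘(ℝ, E) y) y₀)
    (b := Module.finBasis ℝ E) (s := Function.update 0 y w) (x := y) hy (i := i)
  simp only [Function.update_self] at h1
  have h2 := TangentBundle.continuousLinearMapAt_trivializationAt (I := 𝓘(ℝ, E)) hy
  have h3 : (trivializationAt E (fun y : M ↦ TangentSpace 𝓘(ℝ, E) y) y₀ ⟨y, w⟩).2 =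
      mfderiv 𝓘(ℝ, E) 𝓘(ℝ, E) (extChartAt 𝓘(ℝ, E) y₀) y w := by
    refine Eq.trans ?_ (DFunLike.congr_fun h2 w)
    exact (congrFun (Trivialization.coe_linearMapAt_of_mem (R := ℝ)
      (trivializationAt E (fun y : M ↦ TangentSpace 𝓘(ℝ, E) y) y₀) hy) w).symm
  have h4 := mvfderiv_comp_apply (I := 𝓘(ℝ, E)) (I' := 𝓘(ℝ, E)) y
    (g := LinearMap.toContinuousLinearMap ((Module.finBasis ℝ E).coord i))
    (ContinuousLinearMap.differentiableAt _).mdifferentiableAt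
    (mdifferentiableAt_extChartAt (I := 𝓘(ℝ, E)) hy) w
  refine (h1.trans ?_).trans h4.symm
  rw [mvfderiv, mfderiv_eq_fderiv, ContinuousLinearMap.fderiv]
  exact congrArg (fun z ↦ (Module.finBasis ℝ E).repr z i) h3


theorem coeff_frame {y₀ y : M} (hy : y ∈ (chartAt E y₀).source)
    (i j : Fin (Module.finrank ℝ E)) :
    coeff y₀ i y (frame y₀ j y) = if j = i then 1 else 0 := by
  have h1 := Trivialization.localFrameCoeff_apply_of_mem_baseSet (I := 𝓘(ℝ, E))
    (trivializationAt E (fun y : M ↦ TangentSpace 𝓘(ℝ, E) y) y₀)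
    (Module.finBasis ℝ E) (x := y) hy (frame y₀ j) i
  have h2 := Trivialization.localFrame_apply_of_mem_baseSet
    (trivializationAt E (fun y : M ↦ TangentSpace 𝓘(ℝ, E) y) y₀)
    (Module.finBasis ℝ E) (x := y) hy (i := j)
  refine h1.trans ?_
  rw [frame, h2, Module.Basis.repr_self, Finsupp.single_apply]

/-- The fields of a coordinate frame commute. -/
theorem mlieBracket_frame (y₀ : M) (i j : Fin (Module.finrank ℝ E)) :
    VectorField.mlieBracket 𝓘(ℝ, E) (frame y₀ i) (frame y₀ j) y₀ = 0 := by
  rw [← sum_coeff_smul_frame (mem_chart_source E y₀)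
    (VectorField.mlieBracket 𝓘(ℝ, E) (frame y₀ i) (frame y₀ j) y₀)]
  refine Finset.sum_eq_zero fun k _ ↦ ?_
  -- Each frame field differentiates each coordinate function to a constant, 0 or 1, so both terms
  -- of the commutator vanish.
  have hconst (j : Fin (Module.finrank ℝ E)) : mvfderiv 𝓘(ℝ, E)
      (fun q ↦ mvfderiv 𝓘(ℝ, E) (coordFun y₀ k) q (frame y₀ j q)) y₀ = 0 := by
    rw [mvfderiv_congr (k' := fun _ ↦ if j = k then 1 else 0), mvfderiv_const]
    filter_upwards [eventually_mem_chart_source (E := E) y₀] with y hy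
    rw [← coeff_eq_mvfderiv_coordFun hy, coeff_frame hy]
  rw [coeff_eq_mvfderiv_coordFun (mem_chart_source E y₀),
    mvfderiv_mlieBracket (contMDiffAt_coordFun y₀ k) (mdifferentiableAt_frame y₀ i)
      (mdifferentiableAt_frame y₀ j), hconst, hconst]
  simp

/-- The Leibniz rule for linear combinations of vector fields. -/
theorem cov_sum_smul (cov : CovariantDerivative 𝓘(ℝ, E) E (fun x : M ↦ TangentSpace 𝓘(ℝ, E) x))
    {ι : Type*} (t : Finset ι) {a : ι → M → ℝ} {s : ι → ∀ y : M, TangentSpace 𝓘(ℝ, E) y} {y₀ : M}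
    (ha : ∀ i, MDifferentiableAt 𝓘(ℝ, E) 𝓘(ℝ, ℝ) (a i) y₀)
    (hs : ∀ i, MDifferentiableAt 𝓘(ℝ, E) 𝓘(ℝ, E).tangent
      (fun y ↦ (⟨y, s i y⟩ : TangentBundle 𝓘(ℝ, E) M)) y₀) :
    MDifferentiableAt 𝓘(ℝ, E) 𝓘(ℝ, E).tangent
      (fun y ↦ (⟨y, ∑ i ∈ t, a i y • s i y⟩ : TangentBundle 𝓘(ℝ, E) M)) y₀ ∧
    ∀ w, cov (fun y ↦ ∑ i ∈ t, a i y • s i y) y₀ w =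
      ∑ i ∈ t, (mvfderiv 𝓘(ℝ, E) (a i) y₀ w • s i y₀ + a i y₀ • cov (s i) y₀ w) := by
  classical
  have hsm (i) : MDifferentiableAt 𝓘(ℝ, E) 𝓘(ℝ, E).tangent
      (fun y ↦ (⟨y, (a i • s i) y⟩ : TangentBundle 𝓘(ℝ, E) M)) y₀ := (ha i).smul_section (hs i)
  have hd (t : Finset ι) : MDifferentiableAt 𝓘(ℝ, E) 𝓘(ℝ, E).tangent
      (fun y ↦ (⟨y, ∑ i ∈ t, a i y • s i y⟩ : TangentBundle 𝓘(ℝ, E) M)) y₀ :=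
    MDifferentiableAt.sum_section fun i _ ↦ hsm i
  refine ⟨hd t, ?_⟩
  induction t using Finset.induction_on with
  | empty =>
    intro w
    simp only [Finset.sum_empty]
    have := congrFun cov.zero y₀
    exact DFunLike.congr_fun this w
  | insert i t hi ih =>
    intro w
    simp only [Finset.sum_insert hi]
    have h1 : cov (fun y ↦ a i y • s i y + ∑ i ∈ t, a i y • s i y) y₀ =
        cov (a i • s i) y₀ + cov (fun y ↦ ∑ i ∈ t, a i y • s i y) y₀ :=
      cov.isCovariantDerivativeOn.add (hsm i) (hd t) (Set.mem_univ y₀)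
    rw [h1, cov.isCovariantDerivativeOn.leibniz (hs i) (ha i) (Set.mem_univ y₀)]
    simp only [_root_.add_apply, ih w, _root_.smul_apply, ContinuousLinearMap.smulRight_apply]
    abel

theorem cov_congr (cov : CovariantDerivative 𝓘(ℝ, E) E (fun x : M ↦ TangentSpace 𝓘(ℝ, E) x))
    {s s' : ∀ y : M, TangentSpace 𝓘(ℝ, E) y} {y₀ : M}
    (hs : MDifferentiableAt 𝓘(ℝ, E) 𝓘(ℝ, E).tangent
      (fun y ↦ (⟨y, s y⟩ : TangentBundle 𝓘(ℝ, E) M)) y₀)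
    (hs' : MDifferentiableAt 𝓘(ℝ, E) 𝓘(ℝ, E).tangent
      (fun y ↦ (⟨y, s' y⟩ : TangentBundle 𝓘(ℝ, E) M)) y₀)
    (h : ∀ᶠ y in 𝓝 y₀, s y = s' y) : cov s y₀ = cov s' y₀ :=
  cov.isCovariantDerivativeOn.congr_of_eventuallyEq (s := Set.univ) hs hs' Filter.univ_mem h

/-- The covariant derivative, expressed in the coordinate frame. -/
theorem cov_eq_sum_frame
    (cov : CovariantDerivative 𝓘(ℝ, E) E (fun x : M ↦ TangentSpace 𝓘(ℝ, E) x))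
    {s : ∀ y : M, TangentSpace 𝓘(ℝ, E) y} {y₀ : M}
    (hs : MDifferentiableAt 𝓘(ℝ, E) 𝓘(ℝ, E).tangent
      (fun y ↦ (⟨y, s y⟩ : TangentBundle 𝓘(ℝ, E) M)) y₀) (w : TangentSpace 𝓘(ℝ, E) y₀) :
    cov s y₀ w = ∑ i, (mvfderiv 𝓘(ℝ, E) (fun y ↦ coeff y₀ i y (s y)) y₀ w • frame y₀ i y₀ +
      coeff y₀ i y₀ (s y₀) • cov (frame y₀ i) y₀ w) := by
  have h := cov_sum_smul cov Finset.univ (a := fun i y ↦ coeff y₀ i y (s y)) (s := frame y₀)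
    (mdifferentiableAt_coeff hs) (mdifferentiableAt_frame y₀)
  rw [← h.2 w, cov_congr cov hs h.1]
  filter_upwards [eventually_mem_chart_source (E := E) y₀] with y hy
  rw [sum_coeff_smul_frame hy]

end Frame

/-! ### The connection along a map: Leibniz rule, parallel endomorphisms, torsion. -/

section Along

set_option linter.unusedSectionVars false

variable {E : Type*} [NormedAddCommGroup E] [NormedSpace ℝ E] [FiniteDimensional ℝ E]
  {M : Type*} [TopologicalSpace M] [ChartedSpace E M] [IsManifold 𝓘(ℝ, E) ∞ M]
  {E' : Type*} [NormedAddCommGroup E'] [NormedSpace ℝ E'] [FiniteDimensional ℝ E']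
  {N : Type*} [TopologicalSpace N] [ChartedSpace E' N] [IsManifold 𝓘(ℝ, E') ∞ N]
  (cov : CovariantDerivative 𝓘(ℝ, E') E' (fun y : N ↦ TangentSpace 𝓘(ℝ, E') y))
  {f : M → N} {p : M}

theorem covAlong_eq (V : ∀ x : M, TangentSpace 𝓘(ℝ, E') (f x)) (v : TangentSpace 𝓘(ℝ, E) p) :
    covAlong (E := E) cov f V p v =
      ∑ i, (mvfderiv 𝓘(ℝ, E) (fun q ↦ coeff (f p) i (f q) (V q)) p v • frame (f p) i (f p) +
        coeff (f p) i (f p) (V p) •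
          cov (frame (f p) i) (f p) (mfderiv 𝓘(ℝ, E) 𝓘(ℝ, E') f p v)) :=
  rfl

/-- The vector field `V` along `f` is differentiable at `p`. -/
def DifferentiableAlongAt (E : Type*) [NormedAddCommGroup E] [NormedSpace ℝ E]
    {M : Type*} [TopologicalSpace M] [ChartedSpace E M]
    (f : M → N) (V : ∀ x : M, TangentSpace 𝓘(ℝ, E') (f x)) (p : M) : Prop :=
  ∀ i, MDifferentiableAt 𝓘(ℝ, E) 𝓘(ℝ, ℝ) (fun q ↦ coeff (f p) i (f q) (V q)) p

theorem eventually_map_mem_chart_source (hf : ContinuousAt f p) :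
    ∀ᶠ q in 𝓝 p, f q ∈ (chartAt E' (f p)).source :=
  hf.eventually (eventually_mem_chart_source (E := E') (f p))

theorem eventually_eq_sum_coeff_smul_frame (hf : ContinuousAt f p)
    (V : ∀ x : M, TangentSpace 𝓘(ℝ, E') (f x)) :
    ∀ᶠ q in 𝓝 p, V q = ∑ i, coeff (f p) i (f q) (V q) • frame (f p) i (f q) := by
  filter_upwards [eventually_map_mem_chart_source (E' := E') hf] with q hq
  rw [sum_coeff_smul_frame hq]

/-- The covariant derivative along `f` of a combination of vector fields of the target. -/
theorem covAlong_of_eventuallyEq_sum (hf : MDifferentiableAt 𝓘(ℝ, E) 𝓘(ℝ, E') f p)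
    {ι : Type*} [Fintype ι] {V : ∀ x : M, TangentSpace 𝓘(ℝ, E') (f x)} {c : ι → M → ℝ}
    {s : ι → ∀ y : N, TangentSpace 𝓘(ℝ, E') y}
    (hc : ∀ a, MDifferentiableAt 𝓘(ℝ, E) 𝓘(ℝ, ℝ) (c a) p)
    (hs : ∀ a, MDifferentiableAt 𝓘(ℝ, E') 𝓘(ℝ, E').tangent
      (fun y ↦ (⟨y, s a y⟩ : TangentBundle 𝓘(ℝ, E') N)) (f p))
    (hV : ∀ᶠ q in 𝓝 p, V q = ∑ a, c a q • s a (f q)) :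
    DifferentiableAlongAt E f V p ∧ ∀ v, covAlong (E := E) cov f V p v =
      ∑ a, (mvfderiv 𝓘(ℝ, E) (c a) p v • s a (f p) +
        c a p • cov (s a) (f p) (mfderiv 𝓘(ℝ, E) 𝓘(ℝ, E') f p v)) := by
  have hcomp (i a) : MDifferentiableAt 𝓘(ℝ, E) 𝓘(ℝ, ℝ)
      ((fun y ↦ coeff (f p) i y (s a y)) ∘ f) p :=
    (mdifferentiableAt_coeff (hs a) i).comp p hf
  have hev (i) : (fun q ↦ coeff (f p) i (f q) (V q)) =ᶠ[𝓝 p]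
      fun q ↦ ∑ a, c a q * ((fun y ↦ coeff (f p) i y (s a y)) ∘ f) q := by
    filter_upwards [hV] with q hq
    simp [hq]
  have hder (i) := hasMVFDeriv_sum_mul Finset.univ hc (hcomp i)
  refine ⟨fun i ↦ (hder i).1.congr_of_eventuallyEq (hev i), fun v ↦ ?_⟩
  rw [covAlong_eq]
  have h1 (i) (v) := mvfderiv_comp_apply p (mdifferentiableAt_coeff (hs i) v) hf
  have hVp := hV.self_of_nhds
  -- Expand the right side in the coordinate frame too; both sides become double sums matched term
  -- by term, with the chain rule `h1` for the coefficients of `s a` along `f`.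
  have h2 (a) : s a (f p) = ∑ i, coeff (f p) i (f p) (s a (f p)) • frame (f p) i (f p) :=
    (sum_coeff_smul_frame (mem_chart_source E' (f p)) _).symm
  conv_rhs =>
    enter [2, a]
    rw [h2 a, cov_eq_sum_frame cov (hs a), Finset.smul_sum, Finset.smul_sum,
      ← Finset.sum_add_distrib]
  rw [Finset.sum_comm]
  refine Finset.sum_congr rfl fun i _ ↦ ?_
  rw [mvfderiv_congr (hev i), (hder i).2 v, hVp, map_sum, Finset.sum_smul, Finset.sum_smul,
    ← Finset.sum_add_distrib]
  refine Finset.sum_congr rfl fun a _ ↦ ?_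
  rw [h1 a i v]
  simp only [Function.comp_apply, map_smul, smul_eq_mul]
  module

/-- A parallel endomorphism field commutes with the covariant derivative along `f`. -/
theorem covAlong_map (hf : MDifferentiableAt 𝓘(ℝ, E) 𝓘(ℝ, E') f p)
    {F : ∀ y : N, TangentSpace 𝓘(ℝ, E') y →L[ℝ] TangentSpace 𝓘(ℝ, E') y}
    (hF : ContMDiff 𝓘(ℝ, E') (𝓘(ℝ, E').prod 𝓘(ℝ, E' →L[ℝ] E')) ∞
      (fun x ↦ TotalSpace.mk' (E' →L[ℝ] E')
        (E := fun x : N ↦ TangentSpace 𝓘(ℝ, E') x →L[ℝ] TangentSpace 𝓘(ℝ, E') x) x (F x)))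
    (hpar : ∀ (Y : ∀ x : N, TangentSpace 𝓘(ℝ, E') x) (x : N),
      ContMDiffAt 𝓘(ℝ, E') 𝓘(ℝ, E').tangent ∞
        (fun x ↦ (⟨x, Y x⟩ : TangentBundle 𝓘(ℝ, E') N)) x →
      ∀ v : TangentSpace 𝓘(ℝ, E') x, cov (fun y ↦ F y (Y y)) x v - F x (cov Y x v) = 0)
    {V : ∀ x : M, TangentSpace 𝓘(ℝ, E') (f x)} (hV : DifferentiableAlongAt E f V p) :
    DifferentiableAlongAt E f (fun q ↦ F (f q) (V q)) p ∧
    ∀ v, covAlong (E := E) cov f (fun q ↦ F (f q) (V q)) p v =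
      F (f p) (covAlong (E := E) cov f V p v) := by
  have hFd : MDifferentiableAt 𝓘(ℝ, E') (𝓘(ℝ, E').prod 𝓘(ℝ, E' →L[ℝ] E'))
      (fun x ↦ TotalSpace.mk' (E' →L[ℝ] E')
        (E := fun x : N ↦ TangentSpace 𝓘(ℝ, E') x →L[ℝ] TangentSpace 𝓘(ℝ, E') x) x (F x)) (f p) :=
    hF.contMDiffAt.mdifferentiableAt (by simp)
  have hs (i) : MDifferentiableAt 𝓘(ℝ, E') 𝓘(ℝ, E').tangent
      (fun y ↦ (⟨y, F y (frame (f p) i y)⟩ : TangentBundle 𝓘(ℝ, E') N)) (f p) :=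
    MDifferentiableAt.clm_bundle_apply (F₁ := E') (F₂ := E')
      (E₁ := fun x : N ↦ TangentSpace 𝓘(ℝ, E') x) (E₂ := fun x : N ↦ TangentSpace 𝓘(ℝ, E') x)
      hFd (mdifferentiableAt_frame (f p) i)
  -- `F V` has the coefficients of `V` with respect to the fields `F eᵢ`, and parallelism is only
  -- needed for the frame fields `eᵢ`.
  have h := covAlong_of_eventuallyEq_sum cov hf (V := fun q ↦ F (f q) (V q)) hV hs (by
    filter_upwards [eventually_eq_sum_coeff_smul_frame hf.continuousAt V] with q hq
    conv_lhs => rw [hq]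
    simp)
  refine ⟨h.1, fun v ↦ ?_⟩
  rw [h.2 v, covAlong_eq]
  simp only [map_sum, map_add, map_smul]
  refine Finset.sum_congr rfl fun i _ ↦ ?_
  rw [sub_eq_zero.1 (hpar (frame (f p) i) (f p) (contMDiffAt_frame (f p) i) _)]

/-- The coefficients of `df Y`. -/
theorem eventually_coeff_mfderiv (hf : ContMDiffAt 𝓘(ℝ, E) 𝓘(ℝ, E') ∞ f p)
    (i : Fin (Module.finrank ℝ E')) :
    ∀ᶠ q in 𝓝 p, ∀ w : TangentSpace 𝓘(ℝ, E) q,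
      coeff (f p) i (f q) (mfderiv 𝓘(ℝ, E) 𝓘(ℝ, E') f q w) =
        mvfderiv 𝓘(ℝ, E) (coordFun (f p) i ∘ f) q w := by
  have hev : ∀ᶠ q in 𝓝 p, MDifferentiableAt 𝓘(ℝ, E) 𝓘(ℝ, E') f q := by
    have : ContMDiffAt 𝓘(ℝ, E) 𝓘(ℝ, E') 1 f p := hf.of_le (by norm_cast)
    have _ : IsManifold 𝓘(ℝ, E) 1 M := .of_le (n := ∞) (by norm_cast)
    have _ : IsManifold 𝓘(ℝ, E') 1 N := .of_le (n := ∞) (by norm_cast)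
    filter_upwards [(contMDiffAt_iff_contMDiffAt_nhds (by simp)).1 this] with q hq
    exact ContMDiffAt.mdifferentiableAt hq (by simp)
  have hev' : ∀ᶠ y in 𝓝 (f p), MDifferentiableAt 𝓘(ℝ, E') 𝓘(ℝ, ℝ) (coordFun (f p) i) y := by
    have : ContMDiffAt 𝓘(ℝ, E') 𝓘(ℝ, ℝ) 1 (coordFun (f p) i) (f p) :=
      (contMDiffAt_coordFun (f p) i).of_le (by norm_cast)
    have _ : IsManifold 𝓘(ℝ, E') 1 N := .of_le (n := ∞) (by norm_cast)
    filter_upwards [(contMDiffAt_iff_contMDiffAt_nhds (by simp)).1 this] with q hq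
    exact ContMDiffAt.mdifferentiableAt hq (by simp)
  filter_upwards [hev, hf.continuousAt.eventually hev',
    eventually_map_mem_chart_source (E' := E') hf.continuousAt] with q hq hq' hq'' w
  rw [coeff_eq_mvfderiv_coordFun hq'']
  exact (mvfderiv_comp_apply q hq' hq w).symm

theorem contMDiffAt_coordFun_comp (hf : ContMDiffAt 𝓘(ℝ, E) 𝓘(ℝ, E') ∞ f p)
    (i : Fin (Module.finrank ℝ E')) :
    ContMDiffAt 𝓘(ℝ, E) 𝓘(ℝ, ℝ) ∞ (coordFun (f p) i ∘ f) p :=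
  (contMDiffAt_coordFun (f p) i).comp p hf

theorem eventuallyEq_coeff_mfderiv (hf : ContMDiffAt 𝓘(ℝ, E) 𝓘(ℝ, E') ∞ f p)
    (Y : ∀ x : M, TangentSpace 𝓘(ℝ, E) x) (i : Fin (Module.finrank ℝ E')) :
    (fun q ↦ coeff (f p) i (f q) (mfderiv 𝓘(ℝ, E) 𝓘(ℝ, E') f q (Y q))) =ᶠ[𝓝 p]
      fun q ↦ mvfderiv 𝓘(ℝ, E) (coordFun (f p) i ∘ f) q (Y q) := by
  filter_upwards [eventually_coeff_mfderiv hf i] with q hq using hq _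

theorem differentiableAlongAt_mfderiv (hf : ContMDiffAt 𝓘(ℝ, E) 𝓘(ℝ, E') ∞ f p)
    {Y : ∀ x : M, TangentSpace 𝓘(ℝ, E) x}
    (hY : MDifferentiableAt 𝓘(ℝ, E) 𝓘(ℝ, E).tangent
      (fun x ↦ (⟨x, Y x⟩ : TangentBundle 𝓘(ℝ, E) M)) p) :
    DifferentiableAlongAt E f (fun q ↦ mfderiv 𝓘(ℝ, E) 𝓘(ℝ, E') f q (Y q)) p := fun i ↦
  (mdifferentiableAt_mvfderiv_apply (contMDiffAt_coordFun_comp hf i) hY).congr_of_eventuallyEq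
    (eventuallyEq_coeff_mfderiv hf Y i)

/-- If the connection of the target is torsion-free, then so is the connection along `f`. -/
theorem covAlong_mfderiv_sub (htor : cov.torsion = 0) (hf : ContMDiffAt 𝓘(ℝ, E) 𝓘(ℝ, E') ∞ f p)
    {X Y : ∀ x : M, TangentSpace 𝓘(ℝ, E) x}
    (hX : MDifferentiableAt 𝓘(ℝ, E) 𝓘(ℝ, E).tangent
      (fun x ↦ (⟨x, X x⟩ : TangentBundle 𝓘(ℝ, E) M)) p)
    (hY : MDifferentiableAt 𝓘(ℝ, E) 𝓘(ℝ, E).tangent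
      (fun x ↦ (⟨x, Y x⟩ : TangentBundle 𝓘(ℝ, E) M)) p) :
    covAlong (E := E) cov f (fun q ↦ mfderiv 𝓘(ℝ, E) 𝓘(ℝ, E') f q (Y q)) p (X p) -
      covAlong (E := E) cov f (fun q ↦ mfderiv 𝓘(ℝ, E) 𝓘(ℝ, E') f q (X q)) p (Y p) =
    mfderiv 𝓘(ℝ, E) 𝓘(ℝ, E') f p (VectorField.mlieBracket 𝓘(ℝ, E) X Y p) := by
  -- Symmetry of the Christoffel symbols: no torsion, and the frame fields commute.
  have hfr (i j) : cov (frame (f p) i) (f p) (frame (f p) j (f p)) =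
      cov (frame (f p) j) (f p) (frame (f p) i (f p)) := by
    have h := cov.torsion_eq_zero_iff.1 htor (mdifferentiableAt_frame (f p) j)
      (mdifferentiableAt_frame (f p) i)
    rwa [mlieBracket_frame, sub_eq_zero] at h
  have hdf (w : TangentSpace 𝓘(ℝ, E) p) : mfderiv 𝓘(ℝ, E) 𝓘(ℝ, E') f p w =
      ∑ i, mvfderiv 𝓘(ℝ, E) (coordFun (f p) i ∘ f) p w • frame (f p) i (f p) := by
    rw [← sum_coeff_smul_frame (mem_chart_source E' (f p)) (mfderiv 𝓘(ℝ, E) 𝓘(ℝ, E') f p w)]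
    refine Finset.sum_congr rfl fun i _ ↦ ?_
    rw [(eventually_coeff_mfderiv hf i).self_of_nhds]
  -- With `yⁱ` the coordinates, `∇̄_X df Y = ∑ X(Y(yⁱ ∘ f)) eᵢ` plus a Christoffel term. The latter
  -- is symmetric in `X` and `Y`, so only commutators survive in the difference.
  have key (X Y : ∀ x : M, TangentSpace 𝓘(ℝ, E) x) :
      covAlong (E := E) cov f (fun q ↦ mfderiv 𝓘(ℝ, E) 𝓘(ℝ, E') f q (Y q)) p (X p) =
      ∑ i, mvfderiv 𝓘(ℝ, E) (fun q ↦ mvfderiv 𝓘(ℝ, E) (coordFun (f p) i ∘ f) q (Y q)) p (X p) •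
        frame (f p) i (f p) +
      ∑ i, ∑ j, (mvfderiv 𝓘(ℝ, E) (coordFun (f p) i ∘ f) p (Y p) *
        mvfderiv 𝓘(ℝ, E) (coordFun (f p) j ∘ f) p (X p)) •
          cov (frame (f p) i) (f p) (frame (f p) j (f p)) := by
    rw [covAlong_eq, ← Finset.sum_add_distrib]
    refine Finset.sum_congr rfl fun i _ ↦ ?_
    rw [mvfderiv_congr (eventuallyEq_coeff_mfderiv hf Y i),
      (eventually_coeff_mfderiv hf i).self_of_nhds, hdf (X p), map_sum, Finset.smul_sum]
    simp only [map_smul, smul_smul]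
  rw [key X Y, key Y X, hdf]
  have hswap : ∑ i, ∑ j, (mvfderiv 𝓘(ℝ, E) (coordFun (f p) i ∘ f) p (Y p) *
        mvfderiv 𝓘(ℝ, E) (coordFun (f p) j ∘ f) p (X p)) •
          cov (frame (f p) i) (f p) (frame (f p) j (f p)) =
      ∑ i, ∑ j, (mvfderiv 𝓘(ℝ, E) (coordFun (f p) i ∘ f) p (X p) *
        mvfderiv 𝓘(ℝ, E) (coordFun (f p) j ∘ f) p (Y p)) •
          cov (frame (f p) i) (f p) (frame (f p) j (f p)) := by
    rw [Finset.sum_comm]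
    refine Finset.sum_congr rfl fun i _ ↦ Finset.sum_congr rfl fun j _ ↦ ?_
    rw [hfr, mul_comm]
  rw [hswap, add_sub_add_right_eq_sub, ← Finset.sum_sub_distrib]
  refine Finset.sum_congr rfl fun i _ ↦ ?_
  rw [← sub_smul, mvfderiv_mlieBracket (contMDiffAt_coordFun_comp hf i) hX hY]

end Along

/-! ### Metric compatibility along a map, and differentiability tested by inner products. -/

section MetricAlong

set_option linter.unusedSectionVars false

variable {E : Type*} [NormedAddCommGroup E] [NormedSpace ℝ E] [FiniteDimensional ℝ E]
  {M : Type*} [TopologicalSpace M] [ChartedSpace E M] [IsManifold 𝓘(ℝ, E) ∞ M]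
  {E' : Type*} [NormedAddCommGroup E'] [NormedSpace ℝ E'] [FiniteDimensional ℝ E']
  {N : Type*} [TopologicalSpace N] [ChartedSpace E' N] [IsManifold 𝓘(ℝ, E') ∞ N]
  [RiemannianBundle (fun y : N ↦ TangentSpace 𝓘(ℝ, E') y)]
  [IsContMDiffRiemannianBundle 𝓘(ℝ, E') ∞ E' (fun y : N ↦ TangentSpace 𝓘(ℝ, E') y)]

theorem mdifferentiableAt_inner {y₀ : N} {s t : ∀ y : N, TangentSpace 𝓘(ℝ, E') y}
    (hs : MDifferentiableAt 𝓘(ℝ, E') 𝓘(ℝ, E').tangent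
      (fun y ↦ (⟨y, s y⟩ : TangentBundle 𝓘(ℝ, E') N)) y₀)
    (ht : MDifferentiableAt 𝓘(ℝ, E') 𝓘(ℝ, E').tangent
      (fun y ↦ (⟨y, t y⟩ : TangentBundle 𝓘(ℝ, E') N)) y₀) :
    MDifferentiableAt 𝓘(ℝ, E') 𝓘(ℝ, ℝ) (fun y ↦ inner ℝ (s y) (t y)) y₀ :=
  MDifferentiableAt.inner_bundle (F := E') (E := fun y : N ↦ TangentSpace 𝓘(ℝ, E') y)
    (b := fun y ↦ y) hs ht

theorem IsLeviCivita.mvfderiv_inner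
    {cov : CovariantDerivative 𝓘(ℝ, E') E' (fun y : N ↦ TangentSpace 𝓘(ℝ, E') y)}
    (hcov : IsLeviCivita cov) {y₀ : N} {s t : ∀ y : N, TangentSpace 𝓘(ℝ, E') y}
    (hs : MDifferentiableAt 𝓘(ℝ, E') 𝓘(ℝ, E').tangent
      (fun y ↦ (⟨y, s y⟩ : TangentBundle 𝓘(ℝ, E') N)) y₀)
    (ht : MDifferentiableAt 𝓘(ℝ, E') 𝓘(ℝ, E').tangent
      (fun y ↦ (⟨y, t y⟩ : TangentBundle 𝓘(ℝ, E') N)) y₀) (w : TangentSpace 𝓘(ℝ, E') y₀) :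
    mvfderiv 𝓘(ℝ, E') (fun y ↦ (inner ℝ (s y) (t y) : ℝ)) y₀ w =
      inner ℝ (cov s y₀ w) (t y₀) + inner ℝ (s y₀) (cov t y₀ w) := by
  classical
  -- Only the value at `y₀` of the direction field matters, so extension by zero suffices.
  have h := hcov.isMetricCompatible.mvfderiv_inner_eq (Function.update 0 y₀ w) hs ht
  simpa using h

variable {f : M → N} {p : M}

/-- The connection along `f` induced by a Levi-Civita connection is compatible with the metric. -/
theorem IsLeviCivita.mvfderiv_inner_along
    {cov : CovariantDerivative 𝓘(ℝ, E') E' (fun y : N ↦ TangentSpace 𝓘(ℝ, E') y)}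
    (hcov : IsLeviCivita cov) (hf : MDifferentiableAt 𝓘(ℝ, E) 𝓘(ℝ, E') f p)
    {V W : ∀ x : M, TangentSpace 𝓘(ℝ, E') (f x)} (hV : DifferentiableAlongAt E f V p)
    (hW : DifferentiableAlongAt E f W p) :
    MDifferentiableAt 𝓘(ℝ, E) 𝓘(ℝ, ℝ) (fun q ↦ (inner ℝ (V q) (W q) : ℝ)) p ∧
    ∀ v, mvfderiv 𝓘(ℝ, E) (fun q ↦ (inner ℝ (V q) (W q) : ℝ)) p v =
      inner ℝ (covAlong (E := E) cov f V p v) (W p) +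
        inner ℝ (V p) (covAlong (E := E) cov f W p v) := by
  have hg (i j) := mdifferentiableAt_inner (mdifferentiableAt_frame (f p) i)
    (mdifferentiableAt_frame (E := E') (f p) j)
  have hgf (k : Fin (Module.finrank ℝ E') × Fin (Module.finrank ℝ E')) :
      MDifferentiableAt 𝓘(ℝ, E) 𝓘(ℝ, ℝ)
        ((fun y ↦ (inner ℝ (frame (f p) k.1 y) (frame (f p) k.2 y) : ℝ)) ∘ f) p :=
    (hg k.1 k.2).comp p hf
  have hVW (k : Fin (Module.finrank ℝ E') × Fin (Module.finrank ℝ E')) :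
      MDifferentiableAt 𝓘(ℝ, E) 𝓘(ℝ, ℝ) (fun q ↦ coeff (f p) k.1 (f q) (V q) *
        coeff (f p) k.2 (f q) (W q)) p := (hV k.1).mul (hW k.2)
  -- `g(V, W) = ∑ Vⁱ Wʲ gᵢⱼ`, summed over pairs; metric compatibility of the ambient connection is
  -- then needed only for the frame fields in `gᵢⱼ`.
  have hev : (fun q ↦ (inner ℝ (V q) (W q) : ℝ)) =ᶠ[𝓝 p] fun q ↦
      ∑ k : Fin (Module.finrank ℝ E') × Fin (Module.finrank ℝ E'),
        (coeff (f p) k.1 (f q) (V q) * coeff (f p) k.2 (f q) (W q)) *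
        ((fun y ↦ (inner ℝ (frame (f p) k.1 y) (frame (f p) k.2 y) : ℝ)) ∘ f) q := by
    filter_upwards [eventually_eq_sum_coeff_smul_frame hf.continuousAt V,
      eventually_eq_sum_coeff_smul_frame hf.continuousAt W] with q hq hq'
    conv_lhs => rw [hq, hq']
    rw [sum_inner, Fintype.sum_prod_type]
    simp only [inner_sum, real_inner_smul_left, real_inner_smul_right, Function.comp_apply]
    refine Finset.sum_congr rfl fun i _ ↦ Finset.sum_congr rfl fun j _ ↦ ?_
    ring
  have hder := hasMVFDeriv_sum_mul Finset.univ hVW hgf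
  refine ⟨hder.1.congr_of_eventuallyEq hev, fun v ↦ ?_⟩
  have hVp (u : TangentSpace 𝓘(ℝ, E') (f p)) : (inner ℝ (V p) u : ℝ) =
      ∑ i, coeff (f p) i (f p) (V p) * inner ℝ (frame (f p) i (f p)) u := by
    conv_lhs => rw [← sum_coeff_smul_frame (mem_chart_source E' (f p)) (V p), sum_inner]
    simp only [real_inner_smul_left]
  have hWp (u : TangentSpace 𝓘(ℝ, E') (f p)) : (inner ℝ u (W p) : ℝ) =
      ∑ i, coeff (f p) i (f p) (W p) * inner ℝ u (frame (f p) i (f p)) := by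
    conv_lhs => rw [← sum_coeff_smul_frame (mem_chart_source E' (f p)) (W p), inner_sum]
    simp only [real_inner_smul_right]
  rw [mvfderiv_congr hev, hder.2 v, covAlong_eq, covAlong_eq, hVp, sum_inner]
  simp only [hWp, inner_sum, Finset.mul_sum]
  rw [Fintype.sum_prod_type, ← Finset.sum_add_distrib]
  refine Finset.sum_congr rfl fun i _ ↦ ?_
  rw [← Finset.sum_add_distrib]
  refine Finset.sum_congr rfl fun j _ ↦ ?_
  have h1 := mvfderiv_comp_apply p (hg i j) hf v
  rw [h1, hcov.mvfderiv_inner (mdifferentiableAt_frame (f p) i) (mdifferentiableAt_frame (f p) j),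
    mvfderiv_fun_mul (hV i) (hW j)]
  simp only [_root_.add_apply, _root_.smul_apply, smul_eq_mul, inner_add_left, inner_add_right,
    real_inner_smul_left, real_inner_smul_right, Function.comp_apply]
  ring

/-- The solution of a uniquely solvable linear system with differentiable coefficients is
differentiable. -/
theorem mdifferentiableAt_of_linear_system {ι : Type} [Fintype ι] {g : ι → ι → M → ℝ}
    {β c : ι → M → ℝ} (hg : ∀ i j, MDifferentiableAt 𝓘(ℝ, E) 𝓘(ℝ, ℝ) (g i j) p)
    (hβ : ∀ i, MDifferentiableAt 𝓘(ℝ, E) 𝓘(ℝ, ℝ) (β i) p)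
    (hinj : ∀ᶠ q in 𝓝 p, ∀ x : ι → ℝ, (∀ i, ∑ j, g i j q * x j = 0) → x = 0)
    (hc : ∀ᶠ q in 𝓝 p, ∀ i, ∑ j, g i j q * c j q = β i q) (k : ι) :
    MDifferentiableAt 𝓘(ℝ, E) 𝓘(ℝ, ℝ) (c k) p := by
  classical
  -- Matrix units, so that `A y` is the operator with matrix `g i j y`.
  let B (i j : ι) : (ι → ℝ) →L[ℝ] (ι → ℝ) :=
    (ContinuousLinearMap.proj (R := ℝ) (φ := fun _ : ι ↦ ℝ) j).smulRight (Pi.single i 1)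
  let A (y : M) : (ι → ℝ) →L[ℝ] (ι → ℝ) := ∑ i, ∑ j, g i j y • B i j
  have hA : MDifferentiableAt 𝓘(ℝ, E) 𝓘(ℝ, (ι → ℝ) →L[ℝ] (ι → ℝ)) A p := by
    have h1 (i j) : MDifferentiableAt 𝓘(ℝ, E) 𝓘(ℝ, (ι → ℝ) →L[ℝ] (ι → ℝ))
        (fun y ↦ g i j y • B i j) p := (hg i j).smul mdifferentiableAt_const
    have h2 := MDifferentiableAt.sum (t := Finset.univ) (z := p) (I := 𝓘(ℝ, E))
      (f := fun i ↦ ∑ j, fun y ↦ g i j y • B i j)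
      fun i _ ↦ MDifferentiableAt.sum fun j _ ↦ h1 i j
    have h3 : A = ∑ i, ∑ j, fun y ↦ g i j y • B i j := by
      funext y
      simp [A, Finset.sum_apply]
    rwa [h3]
  have hAapp (y : M) (x : ι → ℝ) (i : ι) : A y x i = ∑ j, g i j y * x j := by
    simp [A, B, Pi.single_apply]
  have hequiv : ∀ᶠ y in 𝓝 p, ∃ e : (ι → ℝ) ≃L[ℝ] (ι → ℝ),
      (e : (ι → ℝ) →L[ℝ] (ι → ℝ)) = A y := by
    filter_upwards [hinj] with y hy
    have hi : Function.Injective (A y : (ι → ℝ) →ₗ[ℝ] (ι → ℝ)) := by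
      rw [injective_iff_map_eq_zero]
      intro x hx
      exact hy x fun i ↦ by rw [← hAapp]; exact congrFun hx i
    exact ⟨(LinearEquiv.ofInjectiveEndo _ hi).toContinuousLinearEquiv, by ext x; rfl⟩
  obtain ⟨e, he⟩ := hequiv.self_of_nhds
  have hAinv (i : ι) : MDifferentiableAt 𝓘(ℝ, E) 𝓘(ℝ, ℝ)
      (fun y ↦ (A y).inverse (Pi.single i 1) k) p := by
    have h1 : DifferentiableAt ℝ (fun L : (ι → ℝ) →L[ℝ] (ι → ℝ) ↦ L.inverse (Pi.single i 1) k)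
        (A p) := by
      have h2 : DifferentiableAt ℝ (ContinuousLinearMap.inverse :
          ((ι → ℝ) →L[ℝ] (ι → ℝ)) → _) (A p) := by
        rw [← he]
        exact (contDiffAt_map_inverse (n := 1) e).differentiableAt (by simp)
      have h3 := h2.clm_apply (differentiableAt_const (Pi.single i (1 : ℝ)))
      exact differentiableAt_pi.1 h3 k
    exact h1.mdifferentiableAt.comp p hA
  -- Near `p`, `c k = ∑ βᵢ (A⁻¹ eᵢ)ₖ`, and inversion of operators is differentiable at an invertible
  -- one.
  refine (hasMVFDeriv_sum_mul Finset.univ hβ hAinv).1.congr_of_eventuallyEq ?_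
  filter_upwards [hequiv, hc] with y hy hcy
  obtain ⟨e', he'⟩ := hy
  have h1 : A y (fun k ↦ c k y) = fun i ↦ β i y := by
    ext i
    rw [hAapp, hcy]
  have h2 : (fun k ↦ c k y) = (A y).inverse (fun i ↦ β i y) := by
    rw [← h1, ← he', ContinuousLinearMap.inverse_equiv]
    simp
  have h3 : (fun i ↦ β i y) = ∑ i, β i y • (Pi.single i 1 : ι → ℝ) := by
    ext j
    simp [Finset.sum_apply, Pi.single_apply]
  rw [congrFun h2 k, h3, map_sum, Finset.sum_apply]
  simp

/-- A vector field is differentiable if its inner products with a coordinate frame are. -/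
theorem mdifferentiableAt_of_inner_frame {y₀ : N} {s : ∀ y : N, TangentSpace 𝓘(ℝ, E') y}
    (hs : ∀ i, MDifferentiableAt 𝓘(ℝ, E') 𝓘(ℝ, ℝ)
      (fun y ↦ (inner ℝ (s y) (frame y₀ i y) : ℝ)) y₀) :
    MDifferentiableAt 𝓘(ℝ, E') 𝓘(ℝ, E').tangent
      (fun y ↦ (⟨y, s y⟩ : TangentBundle 𝓘(ℝ, E') N)) y₀ := by
  have hsum (y : N) (x : Fin (Module.finrank ℝ E') → ℝ) (i) :
      ∑ j, inner ℝ (frame y₀ j y) (frame y₀ i y) * x j =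
        inner ℝ (∑ j, x j • frame y₀ j y) (frame y₀ i y) := by
    simp only [sum_inner, real_inner_smul_left, mul_comm]
  have hcoeff (k : Fin (Module.finrank ℝ E')) :
      MDifferentiableAt 𝓘(ℝ, E') 𝓘(ℝ, ℝ) (fun y ↦ coeff y₀ k y (s y)) y₀ := by
    refine mdifferentiableAt_of_linear_system
      (g := fun i j y ↦ inner ℝ (frame y₀ j y) (frame y₀ i y))
      (c := fun k y ↦ coeff y₀ k y (s y))
      (fun i j ↦ mdifferentiableAt_inner (mdifferentiableAt_frame y₀ j)
        (mdifferentiableAt_frame y₀ i)) hs ?_ ?_ k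
    · filter_upwards [eventually_mem_chart_source (E := E') y₀] with y hy x hx
      -- The system is given by the Gram matrix: a vector in its kernel yields a combination of the
      -- frame orthogonal to itself.
      have h0 : ∑ j, x j • frame y₀ j y = 0 := by
        rw [← inner_self_eq_zero (𝕜 := ℝ)]
        conv_lhs => rw [inner_sum]
        refine Finset.sum_eq_zero fun i _ ↦ ?_
        rw [real_inner_smul_right, ← hsum, hx, mul_zero]
      ext k
      have h1 := congrArg (coeff y₀ k y) h0
      simpa [map_sum, coeff_frame hy] using h1
    · filter_upwards [eventually_mem_chart_source (E := E') y₀] with y hy i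
      rw [hsum, sum_coeff_smul_frame hy]
  have : IsManifold 𝓘(ℝ, E') 1 N := .of_le (n := ∞) (by norm_cast)
  exact (mdifferentiableAt_iff_localFrameCoeff (Module.finBasis ℝ E')
    (FiberBundle.mem_baseSet_trivializationAt' y₀)).2 hcoeff

end MetricAlong

/-! ### Linear algebra of a slant subspace. -/

section SlantAlgebra

set_option linter.unusedSectionVars false

variable {V W : Type*} [NormedAddCommGroup V] [InnerProductSpace ℝ V] [FiniteDimensional ℝ V]
  [CompleteSpace V] [NormedAddCommGroup W] [InnerProductSpace ℝ W] [CompleteSpace W]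
  {L : V →L[ℝ] W} {F : W →L[ℝ] W} {D D' : Submodule ℝ V}

/-- A vector orthogonal to `D'` lies in `D` if `D` and `D'` span the space. -/
theorem mem_of_inner_eq_zero (horth : D ⟂ D') (hsup : D ⊔ D' = ⊤) {u : V}
    (hu : ∀ w ∈ D', inner ℝ u w = 0) : u ∈ D := by
  obtain ⟨a, ha, b, hb, rfl⟩ := Submodule.mem_sup.1 (hsup ▸ Submodule.mem_top : u ∈ D ⊔ D')
  have h1 := hu b hb
  rw [inner_add_left, Submodule.isOrtho_iff_inner_eq.1 horth a ha b hb, zero_add,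
    inner_self_eq_zero] at h1
  rwa [h1, add_zero]

theorem inner_map_left_eq_right (hFF : ∀ w, F (F w) = w)
    (hF : ∀ w w', inner ℝ (F w) (F w') = inner ℝ w w') (w w' : W) :
    inner ℝ (F w) w' = inner ℝ w (F w') := by
  rw [← hF w (F w'), hFF]

/-- On a slant subspace with slant angle `θ`, the tangential part of `F` has square `cos² θ`. -/
theorem adjoint_map_adjoint_map_eq_cos_sq_smul (hL : ∀ u v, inner ℝ (L u) (L v) = inner ℝ u v)
    (hFF : ∀ w, F (F w) = w) (hF : ∀ w w', inner ℝ (F w) (F w') = inner ℝ w w')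
    (hD : ∀ u ∈ D, ContinuousLinearMap.adjoint L (F (L u)) ∈ D)
    [(D.map (L : V →ₗ[ℝ] W)).HasOrthogonalProjection] {θ : ℝ}
    (hθ : ∀ u ∈ D, u ≠ 0 → angleWith (F (L u)) (D.map (L : V →ₗ[ℝ] W)) = θ) {u : V}
    (hu : u ∈ D) :
    ContinuousLinearMap.adjoint L (F (L (ContinuousLinearMap.adjoint L (F (L u))))) =
      Real.cos θ ^ 2 • u := by
  have hLn (u : V) : ‖L u‖ = ‖u‖ := by
    rw [← sq_eq_sq₀ (norm_nonneg _) (norm_nonneg _), ← real_inner_self_eq_norm_sq, hL,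
      real_inner_self_eq_norm_sq]
  have hFn (w : W) : ‖F w‖ = ‖w‖ := by
    rw [← sq_eq_sq₀ (norm_nonneg _) (norm_nonneg _), ← real_inner_self_eq_norm_sq, hF,
      real_inner_self_eq_norm_sq]
  set T : V →L[ℝ] V := (ContinuousLinearMap.adjoint L) ∘L F ∘L L with hT
  have hTin (u w : V) : inner ℝ (T u) w = inner ℝ (F (L u)) (L w) :=
    ContinuousLinearMap.adjoint_inner_left L w (F (L u))
  have hTsymm (u w : V) : inner ℝ (T u) w = inner ℝ u (T w) := by
    rw [hTin, inner_map_left_eq_right hFF hF, real_inner_comm, ← hTin, real_inner_comm]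
  have hnorm (u : V) (hu : u ∈ D) : ‖T u‖ ^ 2 = Real.cos θ ^ 2 * ‖u‖ ^ 2 := by
    by_cases h0 : u = 0
    · simp [h0]
    -- `F L u - L T u` is orthogonal to the whole image of `L`, and `T u ∈ D`; so the slant angle is
    -- the angle between `F L u` and `L T u`.
    have hproj : (D.map (L : V →ₗ[ℝ] W)).starProjection (F (L u)) = L (T u) := by
      refine (Submodule.eq_starProjection_of_mem_of_inner_eq_zero
        (Submodule.mem_map_of_mem (f := (L : V →ₗ[ℝ] W)) (hD u hu)) ?_)
      rintro _ ⟨w, -, rfl⟩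
      have h1 : inner ℝ (F (L u) - L (T u)) (L w) = 0 := by
        rw [inner_sub_left, hL, hTin, sub_self]
      exact h1
    have hcos : Real.cos θ * (‖u‖ * ‖T u‖) = ‖T u‖ ^ 2 := by
      rw [← hθ u hu h0, angleWith, hproj, ← hFn (L u) |>.trans (hLn u), ← hLn (T u),
        InnerProductGeometry.cos_angle_mul_norm_mul_norm, ← hTin, hLn,
        real_inner_self_eq_norm_sq]
    -- When `T u = 0`, the angle with the zero vector is `π/2` by convention, so `cos θ = 0`.
    by_cases h1 : ‖T u‖ = 0
    · have hc : Real.cos θ = 0 := by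
        have h2 : L (T u) = 0 := by rw [← norm_eq_zero, hLn, h1]
        rw [← hθ u hu h0, angleWith, hproj, h2, InnerProductGeometry.angle_zero_right,
          Real.cos_pi_div_two]
      simp [h1, hc]
    · have h2 : Real.cos θ * ‖u‖ = ‖T u‖ := by
        refine mul_right_cancel₀ h1 ?_
        rw [mul_assoc, hcos, sq]
      rw [← h2, mul_pow]
  -- Polarization of `‖T u‖² = cos² θ ‖u‖²`; self-adjointness of `T` then makes `T² u - cos² θ u`
  -- orthogonal to itself.
  have hpol (u w : V) (hu : u ∈ D) (hw : w ∈ D) :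
      inner ℝ (T u) (T w) = Real.cos θ ^ 2 * inner ℝ u w := by
    have h1 := hnorm (u + w) (D.add_mem hu hw)
    rw [map_add, norm_add_sq_real, norm_add_sq_real] at h1
    linarith [hnorm u hu, hnorm w hw]
  have hmem : T (T u) - Real.cos θ ^ 2 • u ∈ D :=
    D.sub_mem (hD _ (hD u hu)) (D.smul_mem _ hu)
  have hzero : T (T u) - Real.cos θ ^ 2 • u = 0 := by
    rw [← inner_self_eq_zero (𝕜 := ℝ)]
    conv_lhs => rw [inner_sub_left, hTsymm, real_inner_smul_left, hpol _ _ hu hmem, sub_self]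
  exact sub_eq_zero.1 hzero

end SlantAlgebra

/-! ### Gauss formula, second fundamental form and the bi-slant identities. -/

section Submanifold

set_option linter.unusedSectionVars false

variable {E : Type*} [NormedAddCommGroup E] [NormedSpace ℝ E] [FiniteDimensional ℝ E]
  {M : Type*} [TopologicalSpace M] [ChartedSpace E M] [IsManifold 𝓘(ℝ, E) ∞ M]
  [RiemannianBundle (fun x : M ↦ TangentSpace 𝓘(ℝ, E) x)]
  [IsContMDiffRiemannianBundle 𝓘(ℝ, E) ∞ E (fun x : M ↦ TangentSpace 𝓘(ℝ, E) x)]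
  {E' : Type*} [NormedAddCommGroup E'] [NormedSpace ℝ E'] [FiniteDimensional ℝ E']
  {N : Type*} [TopologicalSpace N] [ChartedSpace E' N] [IsManifold 𝓘(ℝ, E') ∞ N]
  [RiemannianBundle (fun y : N ↦ TangentSpace 𝓘(ℝ, E') y)]
  [IsContMDiffRiemannianBundle 𝓘(ℝ, E') ∞ E' (fun y : N ↦ TangentSpace 𝓘(ℝ, E') y)]
  {covN : CovariantDerivative 𝓘(ℝ, E') E' (fun y : N ↦ TangentSpace 𝓘(ℝ, E') y)}
  {F : ∀ y : N, TangentSpace 𝓘(ℝ, E') y →L[ℝ] TangentSpace 𝓘(ℝ, E') y}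
  {f : M → N} {p : M}

/-- The Gauss formula: the tangential part of the ambient connection is the intrinsic one. -/
theorem inner_covAlong_mfderiv (hcovN : IsLeviCivita covN)
    (hf : IsIsometricImmersion (E := E) (E' := E') f)
    {cov : CovariantDerivative 𝓘(ℝ, E) E (fun x : M ↦ TangentSpace 𝓘(ℝ, E) x)}
    (hcov : IsLeviCivita cov) {X Y Z : ∀ x : M, TangentSpace 𝓘(ℝ, E) x}
    (hX : MDifferentiableAt 𝓘(ℝ, E) 𝓘(ℝ, E).tangent
      (fun x ↦ (⟨x, X x⟩ : TangentBundle 𝓘(ℝ, E) M)) p)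
    (hY : MDifferentiableAt 𝓘(ℝ, E) 𝓘(ℝ, E).tangent
      (fun x ↦ (⟨x, Y x⟩ : TangentBundle 𝓘(ℝ, E) M)) p)
    (hZ : MDifferentiableAt 𝓘(ℝ, E) 𝓘(ℝ, E).tangent
      (fun x ↦ (⟨x, Z x⟩ : TangentBundle 𝓘(ℝ, E) M)) p) :
    (inner ℝ (covAlong (E := E) covN f (fun q ↦ mfderiv 𝓘(ℝ, E) 𝓘(ℝ, E') f q (Y q)) p (X p))
      (mfderiv 𝓘(ℝ, E) 𝓘(ℝ, E') f p (Z p)) : ℝ) = inner ℝ (cov Y p (X p)) (Z p) := by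
  have hfp : ContMDiffAt 𝓘(ℝ, E) 𝓘(ℝ, E') ∞ f p := hf.contMDiff.contMDiffAt
  -- The difference of the two connections is skew in the last two arguments (both are metric) and
  -- symmetric in the first two (both are torsion-free). Alternating the two rules six times returns
  -- to `δ X Y Z` with a minus sign.
  let δ (X Y Z : ∀ x : M, TangentSpace 𝓘(ℝ, E) x) : ℝ :=
    inner ℝ (covAlong (E := E) covN f (fun q ↦ mfderiv 𝓘(ℝ, E) 𝓘(ℝ, E') f q (Y q)) p (X p))
      (mfderiv 𝓘(ℝ, E) 𝓘(ℝ, E') f p (Z p)) - inner ℝ (cov Y p (X p)) (Z p)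
  have hskew (X Y Z : ∀ x : M, TangentSpace 𝓘(ℝ, E) x)
      (hY : MDifferentiableAt 𝓘(ℝ, E) 𝓘(ℝ, E).tangent
        (fun x ↦ (⟨x, Y x⟩ : TangentBundle 𝓘(ℝ, E) M)) p)
      (hZ : MDifferentiableAt 𝓘(ℝ, E) 𝓘(ℝ, E).tangent
        (fun x ↦ (⟨x, Z x⟩ : TangentBundle 𝓘(ℝ, E) M)) p) : δ X Y Z = -δ X Z Y := by
    have h1 := (hcovN.mvfderiv_inner_along (hfp.mdifferentiableAt (by simp))
      (differentiableAlongAt_mfderiv hfp hY) (differentiableAlongAt_mfderiv hfp hZ)).2 (X p)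
    have h2 := hcov.mvfderiv_inner hY hZ (X p)
    simp only [hf.inner_mfderiv] at h1
    rw [h2] at h1
    rw [real_inner_comm _ (Y p)] at h1
    rw [real_inner_comm _ (mfderiv 𝓘(ℝ, E) 𝓘(ℝ, E') f p (Y p))] at h1
    simp only [δ]
    linarith
  have hsymm (X Y Z : ∀ x : M, TangentSpace 𝓘(ℝ, E) x)
      (hX : MDifferentiableAt 𝓘(ℝ, E) 𝓘(ℝ, E).tangent
        (fun x ↦ (⟨x, X x⟩ : TangentBundle 𝓘(ℝ, E) M)) p)
      (hY : MDifferentiableAt 𝓘(ℝ, E) 𝓘(ℝ, E).tangent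
        (fun x ↦ (⟨x, Y x⟩ : TangentBundle 𝓘(ℝ, E) M)) p) : δ X Y Z = δ Y X Z := by
    have h1 := covAlong_mfderiv_sub covN hcovN.torsion_eq_zero hfp hX hY
    have h2 := cov.torsion_eq_zero_iff.1 hcov.torsion_eq_zero hX hY
    have h3 := congrArg (fun w ↦ (inner ℝ w (mfderiv 𝓘(ℝ, E) 𝓘(ℝ, E') f p (Z p)) : ℝ)) h1
    simp only [hf.inner_mfderiv, ← h2, inner_sub_left] at h3
    simp only [δ]
    linarith
  have hz : δ X Y Z = 0 := by
    linarith [hskew X Y Z hY hZ, hsymm X Z Y hX hZ, hskew Z X Y hX hY, hsymm Z Y X hZ hY,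
      hskew Y Z X hZ hX, hsymm Y X Z hY hX]
  exact sub_eq_zero.1 hz

theorem normalPart_sub (x : M) (w w' : TangentSpace 𝓘(ℝ, E') (f x)) :
    normalPart (E := E) f x (w - w') = normalPart (E := E) f x w - normalPart (E := E) f x w' := by
  simp only [normalPart, tangentPart, map_sub]
  abel

theorem tangentPart_mfderiv (hf : IsIsometricImmersion (E := E) (E' := E') f) (x : M)
    (u : TangentSpace 𝓘(ℝ, E) x) :
    tangentPart (E' := E') f x (mfderiv 𝓘(ℝ, E) 𝓘(ℝ, E') f x u) = u := by
  refine ext_inner_right ℝ fun w ↦ ?_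
  rw [tangentPart, ContinuousLinearMap.adjoint_inner_left, hf.inner_mfderiv]

/-- The second fundamental form is symmetric. -/
theorem secondFundamentalForm_comm (hcovN : IsLeviCivita covN)
    (hf : IsIsometricImmersion (E := E) (E' := E') f) {X Y : ∀ x : M, TangentSpace 𝓘(ℝ, E) x}
    (hX : MDifferentiableAt 𝓘(ℝ, E) 𝓘(ℝ, E).tangent
      (fun x ↦ (⟨x, X x⟩ : TangentBundle 𝓘(ℝ, E) M)) p)
    (hY : MDifferentiableAt 𝓘(ℝ, E) 𝓘(ℝ, E).tangent
      (fun x ↦ (⟨x, Y x⟩ : TangentBundle 𝓘(ℝ, E) M)) p) :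
    secondFundamentalForm (E := E) covN f X Y p = secondFundamentalForm (E := E) covN f Y X p := by
  have h1 := covAlong_mfderiv_sub covN hcovN.torsion_eq_zero hf.contMDiff.contMDiffAt hX hY
  rw [← sub_eq_zero, secondFundamentalForm, secondFundamentalForm, ← normalPart_sub, h1,
    normalPart, tangentPart_mfderiv hf, sub_self]

/-- The tangential part `TY` of `FY` is differentiable. -/
theorem mdifferentiableAt_tanF (hN : IsLocallyProductRiemannian covN F)
    (hf : IsIsometricImmersion (E := E) (E' := E') f) {Y : ∀ x : M, TangentSpace 𝓘(ℝ, E) x}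
    (hY : MDifferentiableAt 𝓘(ℝ, E) 𝓘(ℝ, E).tangent
      (fun x ↦ (⟨x, Y x⟩ : TangentBundle 𝓘(ℝ, E) M)) p) :
    MDifferentiableAt 𝓘(ℝ, E) 𝓘(ℝ, E).tangent
      (fun x ↦ (⟨x, tanF F f x (Y x)⟩ : TangentBundle 𝓘(ℝ, E) M)) p := by
  have hfp : ContMDiffAt 𝓘(ℝ, E) 𝓘(ℝ, E') ∞ f p := hf.contMDiff.contMDiffAt
  have hfd := hfp.mdifferentiableAt (by simp)
  refine mdifferentiableAt_of_inner_frame fun i ↦ ?_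
  -- The tangential part is taken by the adjoint of `df`, so `g(TY, eᵢ) = g(F df Y, df eᵢ)`, which
  -- is differentiable.
  have h1 := (hN.isLeviCivita.mvfderiv_inner_along hfd
    (covAlong_map covN hfd hN.smooth hN.parallel (differentiableAlongAt_mfderiv hfp hY)).1
    (differentiableAlongAt_mfderiv hfp (mdifferentiableAt_frame p i))).1
  refine h1.congr_of_eventuallyEq (Filter.Eventually.of_forall fun x ↦ ?_)
  exact ContinuousLinearMap.adjoint_inner_left _ _ _

/-- `ωu` is normal, so the tangential part of `w` does not contribute; this replaces `∇̄` by `σ` in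
pairings with `ω`. -/
theorem inner_norF_right (hf : IsIsometricImmersion (E := E) (E' := E') f) (x : M)
    (w : TangentSpace 𝓘(ℝ, E') (f x)) (u : TangentSpace 𝓘(ℝ, E) x) :
    (inner ℝ w (norF F f x u) : ℝ) = inner ℝ (normalPart (E := E) f x w) (norF F f x u) := by
  have h1 : w = normalPart (E := E) f x w +
      mfderiv 𝓘(ℝ, E) 𝓘(ℝ, E') f x (tangentPart (E := E) (E' := E') f x w) := by
    simp [normalPart]
  have h2 : (inner ℝ (mfderiv 𝓘(ℝ, E) 𝓘(ℝ, E') f x (tangentPart (E := E) (E' := E') f x w))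
      (norF F f x u) : ℝ) = 0 := by
    rw [real_inner_comm]
    exact inner_normalPart_mfderiv hf x _ _
  conv_lhs => rw [h1, inner_add_left, h2, add_zero]

theorem map_mfderiv_eq (x : M) (u : TangentSpace 𝓘(ℝ, E) x) :
    F (f x) (mfderiv 𝓘(ℝ, E) 𝓘(ℝ, E') f x u) =
      mfderiv 𝓘(ℝ, E) 𝓘(ℝ, E') f x (tanF F f x u) + norF F f x u := by
  simp [norF, normalPart, tanF]

variable {D₁ D₂ : ∀ x : M, Submodule ℝ (TangentSpace 𝓘(ℝ, E) x)} {θ₁ θ₂ : M → ℝ}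

/-- Supplies the exchanged copy of the key identity, and (ii) from (i). -/
theorem IsPointwiseBiSlant.symm (h : IsPointwiseBiSlant F f D₁ D₂ θ₁ θ₂) :
    IsPointwiseBiSlant F f D₂ D₁ θ₂ θ₁ where
  isometric := h.isometric
  smooth₁ := h.smooth₂
  smooth₂ := h.smooth₁
  orthogonal x := (h.orthogonal x).symm
  sup_eq_top x := by rw [sup_comm, h.sup_eq_top]
  map₁ := h.map₂
  map₂ := h.map₁
  slant₁ := h.slant₂
  slant₂ := h.slant₁

/-- `TU` is orthogonal to `D₂` because `F D₁ ⊥ D₂`, and `D₁` is the orthogonal complement of `D₂` in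
`TM`. -/
theorem IsPointwiseBiSlant.tanF_mem (h : IsPointwiseBiSlant F f D₁ D₂ θ₁ θ₂) {x : M}
    {u : TangentSpace 𝓘(ℝ, E) x} (hu : u ∈ D₁ x) : tanF F f x u ∈ D₁ x := by
  refine mem_of_inner_eq_zero (h.orthogonal x) (h.sup_eq_top x) fun w hw ↦ ?_
  rw [tanF, tangentPart, ContinuousLinearMap.adjoint_inner_left]
  exact h.map₁ x u hu w hw

theorem IsPointwiseBiSlant.projTanF_eq (h : IsPointwiseBiSlant F f D₁ D₂ θ₁ θ₂) {x : M}
    {u : TangentSpace 𝓘(ℝ, E) x} (hu : u ∈ D₁ x) : projTanF F f D₁ x u = tanF F f x u :=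
  Submodule.starProjection_eq_self_iff.2 (h.tanF_mem hu)

theorem IsPointwiseBiSlant.tanF_tanF (hN : IsAlmostProductRiemannian F)
    (h : IsPointwiseBiSlant F f D₁ D₂ θ₁ θ₂) {x : M} {u : TangentSpace 𝓘(ℝ, E) x}
    (hu : u ∈ D₁ x) : tanF F f x (tanF F f x u) = Real.cos (θ₁ x) ^ 2 • u :=
  adjoint_map_adjoint_map_eq_cos_sq_smul (h.isometric.inner_mfderiv x) (hN.sq_eq (f x))
    (hN.inner_map_map (f x)) (fun _ hu ↦ h.tanF_mem hu) (h.slant₁ x) hu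

/-- For `Y` in `D₁` and `Z` in `D₂`, the ambient derivative of `TY` paired with `FZ`. -/
theorem IsPointwiseBiSlant.inner_covAlong_tanF (hN : IsLocallyProductRiemannian covN F)
    (h : IsPointwiseBiSlant F f D₁ D₂ θ₁ θ₂) {Y Z : ∀ x : M, TangentSpace 𝓘(ℝ, E) x}
    (hY : MDifferentiableAt 𝓘(ℝ, E) 𝓘(ℝ, E).tangent
      (fun x ↦ (⟨x, Y x⟩ : TangentBundle 𝓘(ℝ, E) M)) p)
    (hZ : MDifferentiableAt 𝓘(ℝ, E) 𝓘(ℝ, E).tangent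
      (fun x ↦ (⟨x, Z x⟩ : TangentBundle 𝓘(ℝ, E) M)) p)
    (hYD : ∀ x, Y x ∈ D₁ x) (hZD : ∀ x, Z x ∈ D₂ x) (X : ∀ x : M, TangentSpace 𝓘(ℝ, E) x) :
    (inner ℝ (covAlong (E := E) covN f
        (fun q ↦ mfderiv 𝓘(ℝ, E) 𝓘(ℝ, E') f q (tanF F f q (Y q))) p (X p))
      (mfderiv 𝓘(ℝ, E) 𝓘(ℝ, E') f p (tanF F f p (Z p))) : ℝ) +
    inner ℝ (secondFundamentalForm (E := E) covN f X (fun q ↦ tanF F f q (Y q)) p)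
      (norF F f p (Z p)) =
    -(Real.cos (θ₁ p) ^ 2 * inner ℝ (covAlong (E := E) covN f
        (fun q ↦ mfderiv 𝓘(ℝ, E) 𝓘(ℝ, E') f q (Z q)) p (X p))
        (mfderiv 𝓘(ℝ, E) 𝓘(ℝ, E') f p (Y p)) +
      inner ℝ (secondFundamentalForm (E := E) covN f X Z p)
        (norF F f p (tanF F f p (Y p)))) := by
  have hf := h.isometric
  have hfp : ContMDiffAt 𝓘(ℝ, E) 𝓘(ℝ, E') ∞ f p := hf.contMDiff.contMDiffAt
  have hfd := hfp.mdifferentiableAt (by simp)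
  have hTY := differentiableAlongAt_mfderiv hfp (mdifferentiableAt_tanF hN hf hY)
  have hFTY := covAlong_map covN hfd hN.smooth hN.parallel hTY
  have hmet := (hN.isLeviCivita.mvfderiv_inner_along hfd hFTY.1
    (differentiableAlongAt_mfderiv hfp hZ)).2 (X p)
  -- The function differentiated is `g(F T Y, Z)`, zero because `TY` stays in `D₁`.
  have hzero : (fun q ↦ (inner ℝ (F (f q) (mfderiv 𝓘(ℝ, E) 𝓘(ℝ, E') f q (tanF F f q (Y q))))
      (mfderiv 𝓘(ℝ, E) 𝓘(ℝ, E') f q (Z q)) : ℝ)) = fun _ ↦ 0 :=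
    funext fun q ↦ h.map₁ q _ (h.tanF_mem (hYD q)) _ (hZD q)
  rw [hzero, mvfderiv_const, hFTY.2, inner_map_left_eq_right (hN.sq_eq (f p))
    (hN.inner_map_map (f p)), map_mfderiv_eq, map_mfderiv_eq, inner_add_left, inner_add_right,
    h.tanF_tanF hN.toIsAlmostProductRiemannian (hYD p), map_smul, real_inner_smul_left,
    inner_norF_right hf, real_inner_comm _ (norF F f p _),
    inner_norF_right hf p _ (tanF F f p (Y p)),
    real_inner_comm _ (mfderiv 𝓘(ℝ, E) 𝓘(ℝ, E') f p (Y p))] at hmet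
  simp only [secondFundamentalForm]
  have h0 : (0 : TangentSpace 𝓘(ℝ, E) p →L[ℝ] ℝ) (X p) = 0 := rfl
  rw [h0] at hmet
  linarith

/-- For `Y` in `D₁` and `Z` in `D₂`, the mixed component of the intrinsic connection. -/
theorem IsPointwiseBiSlant.sin_sq_sub_sin_sq_mul_inner (hN : IsLocallyProductRiemannian covN F)
    (h : IsPointwiseBiSlant F f D₁ D₂ θ₁ θ₂)
    {cov : CovariantDerivative 𝓘(ℝ, E) E (fun x : M ↦ TangentSpace 𝓘(ℝ, E) x)}
    (hcov : IsLeviCivita cov) {X Y Z : ∀ x : M, TangentSpace 𝓘(ℝ, E) x}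
    (hX : MDifferentiableAt 𝓘(ℝ, E) 𝓘(ℝ, E).tangent
      (fun x ↦ (⟨x, X x⟩ : TangentBundle 𝓘(ℝ, E) M)) p)
    (hY : MDifferentiableAt 𝓘(ℝ, E) 𝓘(ℝ, E).tangent
      (fun x ↦ (⟨x, Y x⟩ : TangentBundle 𝓘(ℝ, E) M)) p)
    (hZ : MDifferentiableAt 𝓘(ℝ, E) 𝓘(ℝ, E).tangent
      (fun x ↦ (⟨x, Z x⟩ : TangentBundle 𝓘(ℝ, E) M)) p)
    (hYD : ∀ x, Y x ∈ D₁ x) (hZD : ∀ x, Z x ∈ D₂ x) :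
    (Real.sin (θ₂ p) ^ 2 - Real.sin (θ₁ p) ^ 2) * inner ℝ (cov Y p (X p)) (Z p) =
      (inner ℝ (secondFundamentalForm (E := E) covN f X Z p)
          (norF F f p (projTanF F f D₁ p (Y p))) +
        inner ℝ (secondFundamentalForm (E := E) covN f X (fun x ↦ projTanF F f D₂ x (Z x)) p)
          (norF F f p (Y p))) +
      (inner ℝ (secondFundamentalForm (E := E) covN f X Y p)
          (norF F f p (projTanF F f D₂ p (Z p))) +
        inner ℝ (secondFundamentalForm (E := E) covN f X (fun x ↦ projTanF F f D₁ x (Y x)) p)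
          (norF F f p (Z p))) := by
  have hf := h.isometric
  have hfp : ContMDiffAt 𝓘(ℝ, E) 𝓘(ℝ, E') ∞ f p := hf.contMDiff.contMDiffAt
  have hfd := hfp.mdifferentiableAt (by simp)
  simp only [h.projTanF_eq (hYD _), h.symm.projTanF_eq (hZD _)]
  have hort {x : M} {u v : TangentSpace 𝓘(ℝ, E) x} (hu : u ∈ D₁ x) (hv : v ∈ D₂ x) :
      (inner ℝ u v : ℝ) = 0 := Submodule.isOrtho_iff_inner_eq.1 (h.orthogonal x) u hu v hv
  have h0 : (0 : TangentSpace 𝓘(ℝ, E) p →L[ℝ] ℝ) (X p) = 0 := rfl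
  have h1 := h.inner_covAlong_tanF hN hY hZ hYD hZD X
  have h2 := h.symm.inner_covAlong_tanF hN hZ hY hZD hYD X
  -- From `TY ⊥ TZ`: the terms `g(∇̄_X TY, TZ)` of `h1` and `g(∇̄_X TZ, TY)` of `h2` are opposite.
  have h3 := (hN.isLeviCivita.mvfderiv_inner_along hfd
    (differentiableAlongAt_mfderiv hfp (mdifferentiableAt_tanF hN hf hY))
    (differentiableAlongAt_mfderiv hfp (mdifferentiableAt_tanF hN hf hZ))).2 (X p)
  simp only [hf.inner_mfderiv, hort (h.tanF_mem (hYD _)) (h.symm.tanF_mem (hZD _))] at h3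
  rw [mvfderiv_const, h0, real_inner_comm _ (mfderiv 𝓘(ℝ, E) 𝓘(ℝ, E') f p _)] at h3
  have h4 := inner_covAlong_mfderiv hN.isLeviCivita hf hcov hX hY hZ
  have h5 := inner_covAlong_mfderiv hN.isLeviCivita hf hcov hX hZ hY
  -- From `Y ⊥ Z`: `g(∇_X Z, Y) = -g(∇_X Y, Z)`, so both cosine terms become multiples of `g(∇_X Y,
  -- Z)`.
  have h6 := hcov.mvfderiv_inner hY hZ (X p)
  simp only [hort (hYD _) (hZD _)] at h6
  rw [mvfderiv_const, h0, real_inner_comm _ (Y p)] at h6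
  rw [h5] at h1
  rw [h4] at h2
  rw [Real.sin_sq, Real.sin_sq]
  have h7 : (inner ℝ (cov Z p (X p)) (Y p) : ℝ) = -inner ℝ (cov Y p (X p)) (Z p) := by linarith
  rw [h7] at h1
  linarith

end Submanifold

end

end BiSlant

/-! ### The two formulas. -/

theorem lemma3p2
    {E : Type*} [NormedAddCommGroup E] [NormedSpace ℝ E] [FiniteDimensional ℝ E]
    {M : Type*} [TopologicalSpace M] [T2Space M] [SecondCountableTopology M]
    [ChartedSpace E M] [IsManifold 𝓘(ℝ, E) ∞ M]
    [RiemannianBundle (fun x : M ↦ TangentSpace 𝓘(ℝ, E) x)]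
    [IsContMDiffRiemannianBundle 𝓘(ℝ, E) ∞ E (fun x : M ↦ TangentSpace 𝓘(ℝ, E) x)]
    {E' : Type*} [NormedAddCommGroup E'] [NormedSpace ℝ E'] [FiniteDimensional ℝ E']
    {N : Type*} [TopologicalSpace N] [T2Space N] [SecondCountableTopology N]
    [ChartedSpace E' N] [IsManifold 𝓘(ℝ, E') ∞ N]
    [RiemannianBundle (fun y : N ↦ TangentSpace 𝓘(ℝ, E') y)]
    [IsContMDiffRiemannianBundle 𝓘(ℝ, E') ∞ E' (fun y : N ↦ TangentSpace 𝓘(ℝ, E') y)]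
    -- the ambient locally product Riemannian manifold
    (covN : CovariantDerivative 𝓘(ℝ, E') E' (fun y : N ↦ TangentSpace 𝓘(ℝ, E') y))
    (F : ∀ y : N, TangentSpace 𝓘(ℝ, E') y →L[ℝ] TangentSpace 𝓘(ℝ, E') y)
    (hN : BiSlant.IsLocallyProductRiemannian covN F)
    -- the pointwise bi-slant submanifold and its Levi-Civita connection
    (f : M → N) (D₁ D₂ : ∀ x : M, Submodule ℝ (TangentSpace 𝓘(ℝ, E) x)) (θ₁ θ₂ : M → ℝ)
    (hM : BiSlant.IsPointwiseBiSlant F f D₁ D₂ θ₁ θ₂) (hθ : θ₁ ≠ θ₂)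
    (cov : CovariantDerivative 𝓘(ℝ, E) E (fun x : M ↦ TangentSpace 𝓘(ℝ, E) x))
    (hcov : BiSlant.IsLeviCivita cov) :
    let σ := BiSlant.secondFundamentalForm (E := E) covN f
    let om := BiSlant.norF (E := E) F f
    let T₁ := BiSlant.projTanF F f D₁
    let T₂ := BiSlant.projTanF F f D₂
    (∀ X Y Z : ∀ x : M, TangentSpace 𝓘(ℝ, E) x,
      BiSlant.IsSmoothField X → BiSlant.IsSmoothField Y → BiSlant.IsSmoothField Z →
      (∀ x, X x ∈ D₁ x) → (∀ x, Y x ∈ D₁ x) → (∀ x, Z x ∈ D₂ x) →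
      ∀ p : M,
        (Real.sin (θ₂ p) ^ 2 - Real.sin (θ₁ p) ^ 2) * inner ℝ (cov Y p (X p)) (Z p) =
          (inner ℝ (σ X Z p) (om p (T₁ p (Y p))) +
            inner ℝ (σ X (fun x ↦ T₂ x (Z x)) p) (om p (Y p))) +
          (inner ℝ (σ X Y p) (om p (T₂ p (Z p))) +
            inner ℝ (σ X (fun x ↦ T₁ x (Y x)) p) (om p (Z p)))) ∧
    (∀ Z W X : ∀ x : M, TangentSpace 𝓘(ℝ, E) x,
      BiSlant.IsSmoothField Z → BiSlant.IsSmoothField W → BiSlant.IsSmoothField X →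
      (∀ x, Z x ∈ D₂ x) → (∀ x, W x ∈ D₂ x) → (∀ x, X x ∈ D₁ x) →
      ∀ p : M,
        (Real.sin (θ₁ p) ^ 2 - Real.sin (θ₂ p) ^ 2) * inner ℝ (cov W p (Z p)) (X p) =
          (inner ℝ (σ X Z p) (om p (T₂ p (W p))) +
            inner ℝ (σ Z (fun x ↦ T₁ x (X x)) p) (om p (W p))) +
          (inner ℝ (σ Z W p) (om p (T₁ p (X p))) +
            inner ℝ (σ Z (fun x ↦ T₂ x (W x)) p) (om p (X p)))) := by
  intro σ om T₁ T₂
  have hd {X : ∀ x : M, TangentSpace 𝓘(ℝ, E) x} (hX : BiSlant.IsSmoothField X) (p : M) :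
      MDifferentiableAt 𝓘(ℝ, E) 𝓘(ℝ, E).tangent
        (fun x ↦ (⟨x, X x⟩ : TangentBundle 𝓘(ℝ, E) M)) p :=
    hX.contMDiffAt.mdifferentiableAt (by simp)
  refine ⟨fun X Y Z hX hY hZ _ hYD hZD p ↦ ?_, fun Z W X hZ hW hX _ hWD hXD p ↦ ?_⟩
  · exact hM.sin_sq_sub_sin_sq_mul_inner hN hcov (hd hX p) (hd hY p) (hd hZ p) hYD hZD
  -- The exchanged identity produces `σ(Z, X)` in its first term, where (ii) has `σ(X, Z)`.
  · have hcomm : σ X Z p = σ Z X p :=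
      BiSlant.secondFundamentalForm_comm hN.isLeviCivita hM.isometric (hd hX p) (hd hZ p)
    rw [hcomm]
    exact hM.symm.sin_sq_sub_sin_sq_mul_inner hN hcov (hd hZ p) (hd hW p) (hd hX p) hWD hXD
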